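/- Let $\Omega\subset\mathbb{R}^2$ be a bounded domain with Lipschitz boundary $\Gamma=\partial\Omega$ and outward unit normal $n$ (defined almost everywhere on $\Gamma$ with respect to arc length $ds$), let $T,\rho,\mu,g>0$, and let $\zeta\in C^1(\overline\Omega)$ with $\zeta>0$ on $\overline\Omega$. Suppose that $\phi:\overline\Omega\times[0,T]\to\mathbb{R}$ and $u:\overline\Omega\times[0,T]\to\mathbb{R}^2$ are smooth ($C^\infty$ up to the boundary) and, with $\eta=\phi-\zeta$ and $D(u)=\frac12\left(\nabla u+(\nabla u)^T\right)$, satisfy the viscous shallow water equations $$\frac{\partial\phi}{\partial t}+\nabla\cdot(\phi u)=0,\qquad \rho\phi\left[\frac{\partial u}{\partial t}+(u\cdot\nabla)u\right]-2\mu\nabla\cdot(\phi D(u))+\rho g\phi\nabla\eta=0\qquad\text{in }\Omega\times(0,T).$$ Let $$E(t)=\int_\Omega\frac{\rho}{2}\phi|u|^2\,dx+\int_\Omega\frac{\rho g|\eta|^2}{2}\,dx,\qquad t\in[0,T].$$ Then $n$ exists almost everywhere on $\Gamma$, and for every $t\in[0,T]$ all the integrals above and below converge, $E$ is differentiable at $t$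 (one-sidedly at $t=0$ and $t=T$), and $$\frac{d}{dt}E(t)=I_1(t)+I_2(t)+I_3(t)+I_4(t),$$ where $$I_1(t)=-\frac{\rho}{2}\int_\Gamma\phi|u|^2\,u\cdot n\,ds,\qquad I_2(t)=-\rho g\int_\Gamma\phi\eta\,u\cdot n\,ds,$$ $$I_3(t)=2\mu\int_\Gamma\phi\,[D(u)n]\cdot u\,ds,\qquad I_4(t)=-2\mu\int_\Omega\phi|D(u)|^2\,dx,$$ and $|D(u)|^2=\sum_{i,j=1}^2 D(u)_{ij}^2$. -/

import Mathlib

open MeasureTheory Set Filter Topology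
open scoped ContDiff NNReal

namespace ShallowWater

/-- The Euclidean plane. -/
abbrev Plane : Type := EuclideanSpace ℝ (Fin 2)

/-- A bounded domain (nonempty connected open set) in the plane with Lipschitz boundary: near each
boundary point, up to an isometry of the plane, the set is the region strictly below the graph of a
Lipschitz function. -/
structure IsBoundedLipschitzDomain (Ω : Set Plane) : Prop where
  isOpen : IsOpen Ω
  isConnected : IsConnected Ω
  isBounded : Bornology.IsBounded Ω
  exists_chart : ∀ p ∈ frontier Ω,
    ∃ (e : Plane ≃ₗᵢ[ℝ] Plane) (K : ℝ≥0) (f : ℝ → ℝ) (U : Set Plane),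
      LipschitzWith K f ∧ IsOpen U ∧ p ∈ U ∧ ∀ y ∈ U, (y ∈ Ω ↔ (e y) 1 < f ((e y) 0))

/-- `ν` is the outward unit normal vector of `Ω` at `x`: up to an error `o(|y - x|)`, the set `Ω`
near `x` is the half-plane `⟨y - x, ν⟩ < 0`. There is at most one such `ν`. -/
def IsOutwardUnitNormal (Ω : Set Plane) (x ν : Plane) : Prop :=
  ‖ν‖ = 1 ∧ ∀ ε > 0, ∀ᶠ y in 𝓝 x,
    (y ∈ Ω → inner ℝ (y - x) ν ≤ ε * ‖y - x‖) ∧ (y ∉ Ω → -(ε * ‖y - x‖) ≤ inner ℝ (y - x) ν)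

open Classical in
/-- The outward unit normal vector `n(x)`; zero at the points where there is none. -/
noncomputable def outwardNormal (Ω : Set Plane) (x : Plane) : Plane :=
  if h : ∃ ν, IsOutwardUnitNormal Ω x ν then h.choose else 0

/-- The measure `ds` on `Γ = ∂Ω`: one-dimensional Hausdorff measure (arc length) on the boundary. -/
noncomputable def arcLength (Ω : Set Plane) : Measure Plane := (μH[1]).restrict (frontier Ω)

/-- The partial derivative `∂f/∂xⱼ` at a point `x` of the closure of `Ω`. On the open set `Ω` it is
the ordinary partial derivative; at a boundary point the derivative is taken relative to the
closure of `Ω`. -/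
noncomputable def pderiv (Ω : Set Plane) (j : Fin 2) (f : Plane → ℝ) (x : Plane) : ℝ :=
  fderivWithin ℝ f (closure Ω) x (EuclideanSpace.single j 1)

/-- The entries of the strain-rate tensor `D(v) = (∇v + (∇v)ᵀ) / 2`. -/
noncomputable def strain (Ω : Set Plane) (v : Plane → Plane) (x : Plane) (i j : Fin 2) : ℝ :=
  (pderiv Ω j (fun y => v y i) x + pderiv Ω i (fun y => v y j) x) / 2

/-- The water level `η = φ - ζ` from the reference height. -/
def elevation (ζ : Plane → ℝ) (φ : Plane → ℝ → ℝ) (x : Plane) (t : ℝ) : ℝ := φ x t - ζ x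

/-- `(φ, u)` is smooth on `closure Ω × [0, T]` and satisfies the viscous shallow water equations
in `Ω × (0, T)`; the relation `φ = η + ζ` holds by the definition of `η`. -/
structure IsSmoothSolution (Ω : Set Plane) (T ρ μ g : ℝ) (ζ : Plane → ℝ)
    (φ : Plane → ℝ → ℝ) (u : Plane → ℝ → Plane) : Prop where
  smooth_height : ContDiffOn ℝ ∞ (fun p : Plane × ℝ => φ p.1 p.2) (closure Ω ×ˢ Icc 0 T)
  smooth_velocity : ContDiffOn ℝ ∞ (fun p : Plane × ℝ => u p.1 p.2) (closure Ω ×ˢ Icc 0 T)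
  /-- `∂φ/∂t + ∇·(φ u) = 0` -/
  mass : ∀ x ∈ Ω, ∀ t ∈ Ioo 0 T,
    deriv (fun s => φ x s) t + ∑ j, pderiv Ω j (fun y => φ y t * u y t j) x = 0
  /-- `ρ φ [∂u/∂t + (u·∇)u] - 2μ ∇·(φ D(u)) + ρ g φ ∇η = 0` -/
  momentum : ∀ x ∈ Ω, ∀ t ∈ Ioo 0 T, ∀ i : Fin 2,
    ρ * φ x t * (deriv (fun s => u x s i) t + ∑ j, u x t j * pderiv Ω j (fun y => u y t i) x)
      - 2 * μ * ∑ j, pderiv Ω j (fun y => φ y t * strain Ω (fun z => u z t) y i j) x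
      + ρ * g * φ x t * pderiv Ω i (fun y => elevation ζ φ y t) x = 0

/-- The integrand `(ρ/2) φ |u|²` of the kinetic energy `E₁`. -/
noncomputable def kineticDensity (ρ : ℝ) (φ : Plane → ℝ → ℝ) (u : Plane → ℝ → Plane)
    (t : ℝ) (x : Plane) : ℝ :=
  ρ / 2 * φ x t * ‖u x t‖ ^ 2

/-- The integrand `ρ g |η|² / 2` of the potential energy `E₂`. -/
noncomputable def potentialDensity (ρ g : ℝ) (ζ : Plane → ℝ) (φ : Plane → ℝ → ℝ)
    (t : ℝ) (x : Plane) : ℝ :=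
  ρ * g * |elevation ζ φ x t| ^ 2 / 2

/-- The integrand `φ |u|² u·n` of `I₁`. -/
noncomputable def kineticFlux (Ω : Set Plane) (φ : Plane → ℝ → ℝ) (u : Plane → ℝ → Plane)
    (t : ℝ) (x : Plane) : ℝ :=
  φ x t * ‖u x t‖ ^ 2 * inner ℝ (u x t) (outwardNormal Ω x)

/-- The integrand `φ η u·n` of `I₂`. -/
noncomputable def potentialFlux (Ω : Set Plane) (ζ : Plane → ℝ) (φ : Plane → ℝ → ℝ)
    (u : Plane → ℝ → Plane) (t : ℝ) (x : Plane) : ℝ :=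
  φ x t * elevation ζ φ x t * inner ℝ (u x t) (outwardNormal Ω x)

/-- The integrand `φ [D(u) n]·u` of `I₃`. -/
noncomputable def viscousFlux (Ω : Set Plane) (φ : Plane → ℝ → ℝ) (u : Plane → ℝ → Plane)
    (t : ℝ) (x : Plane) : ℝ :=
  φ x t * ∑ i, (∑ j, strain Ω (fun z => u z t) x i j * outwardNormal Ω x j) * u x t i

/-- The integrand `φ |D(u)|²` of `I₄`, where `|D|² = D : D` is the sum of the squared entries. -/
noncomputable def dissipationDensity (Ω : Set Plane) (φ : Plane → ℝ → ℝ) (u : Plane → ℝ → Plane)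
    (t : ℝ) (x : Plane) : ℝ :=
  φ x t * ∑ i, ∑ j, strain Ω (fun z => u z t) x i j ^ 2

/-- The total energy `E = E₁ + E₂`. -/
noncomputable def energy (Ω : Set Plane) (ρ g : ℝ) (ζ : Plane → ℝ) (φ : Plane → ℝ → ℝ)
    (u : Plane → ℝ → Plane) (t : ℝ) : ℝ :=
  (∫ x in Ω, kineticDensity ρ φ u t x) + ∫ x in Ω, potentialDensity ρ g ζ φ t x

noncomputable def I₁ (Ω : Set Plane) (ρ : ℝ) (φ : Plane → ℝ → ℝ) (u : Plane → ℝ → Plane)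
    (t : ℝ) : ℝ :=
  -(ρ / 2) * ∫ x, kineticFlux Ω φ u t x ∂arcLength Ω

noncomputable def I₂ (Ω : Set Plane) (ρ g : ℝ) (ζ : Plane → ℝ) (φ : Plane → ℝ → ℝ)
    (u : Plane → ℝ → Plane) (t : ℝ) : ℝ :=
  -(ρ * g) * ∫ x, potentialFlux Ω ζ φ u t x ∂arcLength Ω

noncomputable def I₃ (Ω : Set Plane) (μ : ℝ) (φ : Plane → ℝ → ℝ) (u : Plane → ℝ → Plane)
    (t : ℝ) : ℝ :=
  2 * μ * ∫ x, viscousFlux Ω φ u t x ∂arcLength Ω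

noncomputable def I₄ (Ω : Set Plane) (μ : ℝ) (φ : Plane → ℝ → ℝ) (u : Plane → ℝ → Plane)
    (t : ℝ) : ℝ :=
  -(2 * μ) * ∫ x in Ω, dissipationDensity Ω φ u t x

end ShallowWater

/-! Take the scalar product of the momentum equation with `u` and add the mass equation multiplied
by (ρ/2)|u|² + ρgη. Since ζ does not depend on time, ∂η/∂t = ∂φ/∂t; since D(u) is symmetric, D(u) :
∇u = |D(u)|². The result is the pointwise balance `energyRate_eq`: the time derivative of the energy
density equals -(ρ/2)∇·(φ|u|²u) - ρg∇·(φηu) + 2μ∇·(φD(u)u) - 2μφ|D(u)|². By continuity the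
equations, and so the balance, also hold at t = 0 and t = T. Differentiating under the integral sign
and applying the divergence theorem to the three fields gives the identity.

Most of the work is the divergence theorem on a bounded Lipschitz domain, with Hausdorff measure on
the boundary and the normal defined by first-order approximation. A partition of unity reduces it to
a function supported in one graph chart. The area-preserving shear (x, z) ↦ (x, f x + z) straightens
the graph without differentiating `f`. Vertical derivatives then integrate along vertical half-lines
to boundary values, and derivatives along the shifted graphs integrate to zero, so that ∫ ∂ᵥh = ∫ h
(v₁ - f' v₀) dx (`IsSubgraphTest.setIntegral_fderiv`).

The right side is a surface integral for two reasons. By Rademacher's theorem the graph has the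
normal (-f', 1)/√(1 + f'²) almost everywhere, and the area formula
`hausdorffMeasure_restrict_range_eq_map` identifies arc length on the graph with √(1 + f'²) dx. -/

namespace ShallowWater

/-! ### Area formula for Lipschitz curves that do not shrink distances -/

section Area

open ENNReal Measure

variable {F : Type*} [NormedAddCommGroup F]

theorem enorm_sub_enorm_le_coe {x y : F} {ε : ℝ≥0} (h : ‖x - y‖ ≤ ε) : ‖x‖ₑ ≤ ‖y‖ₑ + ε := by
  have : ‖x‖₊ ≤ ‖y‖₊ + ε := by
    rw [← NNReal.coe_le_coe]; push_cast
    linarith [norm_le_norm_add_norm_sub' x y]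
  simpa [enorm] using ENNReal.coe_le_coe.2 this

/-- In one dimension, a linear approximation on a set approximates the derivative almost
everywhere. -/
theorem ae_norm_deriv_sub_le_of_approximatesLinearOn [NormedSpace ℝ F]
    {γ : ℝ → F} {A : ℝ →L[ℝ] F} {s : Set ℝ} {ε : ℝ≥0}
    (hs : MeasurableSet s) (h : ApproximatesLinearOn γ A s ε)
    (hd : ∀ x ∈ s, DifferentiableAt ℝ γ x) :
    ∀ᵐ x ∂volume.restrict s, ‖deriv γ x - A 1‖ ≤ ε := by
  -- Approximation on `s` says nothing about the derivative at an isolated point of `s`. Such points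
  -- are isolated from the right, hence countable and negligible.
  have hc : {x ∈ s | 𝓝[s \ {x}] x = ⊥}.Countable := by
    have := countable_setOfPred_isolated_right_within (s := s)
    refine this.mono fun x hx => (⟨hx.1, ?_⟩ : x ∈ s ∧ 𝓝[s ∩ Ioi x] x = ⊥)
    refine le_bot_iff.1 (le_trans (nhdsWithin_mono _ ?_) hx.2.le)
    rintro y ⟨hy, hxy⟩
    exact ⟨hy, fun h => (ne_of_gt hxy) h⟩
  rw [ae_restrict_iff' hs]
  have h0 : ∀ᵐ x, x ∉ {x ∈ s | 𝓝[s \ {x}] x = ⊥} := measure_eq_zero_iff_ae_notMem.1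
    (hc.measure_zero volume)
  filter_upwards [h0] with x hx hxs
  have hne : (𝓝[s \ {x}] x).NeBot := ⟨fun h => hx ⟨hxs, h⟩⟩
  have hder := ((hd x hxs).hasDerivAt.hasDerivWithinAt (s := s))
  rw [hasDerivWithinAt_iff_tendsto_slope] at hder
  have ht : Tendsto (fun y => ‖slope γ x y - A 1‖) (𝓝[s \ {x}] x) (𝓝 ‖deriv γ x - A 1‖) :=
    (hder.sub_const _).norm
  refine le_of_tendsto ht ?_
  filter_upwards [self_mem_nhdsWithin] with y hy
  have hyx : 0 < |y - x| := abs_pos.2 (sub_ne_zero.2 hy.2)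
  have h1 := h y hy.1 x hxs
  have h2 : slope γ x y - A 1 = (y - x)⁻¹ • (γ y - γ x - A (y - x)) := by
    have : A (y - x) = (y - x) • A 1 := by rw [← map_smul, smul_eq_mul, mul_one]
    rw [this, smul_sub, smul_smul, inv_mul_cancel₀ (sub_ne_zero.2 hy.2), one_smul, slope_def_module]
  rw [h2, norm_smul, norm_inv, Real.norm_eq_abs, inv_mul_le_iff₀ hyx, mul_comm]
  simpa using h1

variable [MeasurableSpace F] [BorelSpace F]

/-- Expansion by at least the factor `c` on `s` expands the length of `s` at least as much. -/
theorem mul_volume_le_hausdorffMeasure_image {γ : ℝ → F} {s : Set ℝ} {c : ℝ≥0}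
    (h : ∀ x ∈ s, ∀ y ∈ s, c * |x - y| ≤ ‖γ x - γ y‖) :
    c * volume s ≤ μH[1] (γ '' s) := by
  rcases eq_or_ne c 0 with rfl | hc
  · simp
  have hc' : (0 : ℝ) < c := by positivity
  have hinj : InjOn γ s := by
    intro x hx y hy hxy
    have := h x hx y hy
    rw [hxy, sub_self, norm_zero] at this
    have h0 : |x - y| ≤ 0 := by
      by_contra! h1
      nlinarith [mul_pos hc' h1]
    exact sub_eq_zero.1 (abs_nonpos_iff.1 h0)
  -- The inverse of `γ` on the image is `c⁻¹`-Lipschitz, so it enlarges length at most by `c⁻¹`.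
  have hL : LipschitzOnWith c⁻¹ (Function.invFunOn γ s) (γ '' s) := by
    refine LipschitzOnWith.of_dist_le_mul ?_
    rintro _ ⟨x, hx, rfl⟩ _ ⟨y, hy, rfl⟩
    rw [hinj.leftInvOn_invFunOn hx, hinj.leftInvOn_invFunOn hy, Real.dist_eq, dist_eq_norm]
    rw [NNReal.coe_inv, inv_mul_eq_div, le_div_iff₀ hc', mul_comm]
    exact h x hx y hy
  have himg : Function.invFunOn γ s '' (γ '' s) = s := hinj.leftInvOn_invFunOn.image_image
  have := hL.hausdorffMeasure_image_le (d := 1) zero_le_one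
  rw [himg, hausdorffMeasure_real, ENNReal.rpow_one, ENNReal.coe_inv hc] at this
  calc (c : ℝ≥0∞) * volume s ≤ c * ((c : ℝ≥0∞)⁻¹ * μH[1] (γ '' s)) := by gcongr
    _ = μH[1] (γ '' s) := by
      rw [← mul_assoc, ENNReal.mul_inv_cancel (by simpa using hc) coe_ne_top, one_mul]

theorem hausdorffMeasure_image_le_mul_volume {γ : ℝ → F} {s : Set ℝ} {c : ℝ≥0}
    (h : ∀ x ∈ s, ∀ y ∈ s, ‖γ x - γ y‖ ≤ c * |x - y|) :
    μH[1] (γ '' s) ≤ c * volume s := by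
  have hL : LipschitzOnWith c γ s := LipschitzOnWith.of_dist_le_mul fun x hx y hy => by
    rw [Real.dist_eq, dist_eq_norm]; exact h x hx y hy
  have := hL.hausdorffMeasure_image_le (d := 1) zero_le_one
  rwa [hausdorffMeasure_real, ENNReal.rpow_one] at this

variable [NormedSpace ℝ F]

/-- Cut `s` into countably many pieces on which `γ` is `ε`-close to a linear map `A`. On each piece
both the length of the image and the integral of ‖γ'‖ differ from ‖A 1‖ times the length of the
piece by at most `ε` times that length; hence the factor 2. Two inequalities avoid subtraction in
`ℝ≥0∞`. -/
theorem hausdorffMeasure_image_approx [FiniteDimensional ℝ F] {γ : ℝ → F} {K : ℝ≥0}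
    (hγ : LipschitzWith K γ) (hγ' : ∀ x y, |x - y| ≤ ‖γ x - γ y‖) {s : Set ℝ}
    (hs : MeasurableSet s) {ε : ℝ≥0} (hε : ε ≠ 0) :
    μH[1] (γ '' s) ≤ (∫⁻ x in s, ‖deriv γ x‖ₑ) + 2 * ε * volume s ∧
    (∫⁻ x in s, ‖deriv γ x‖ₑ) ≤ μH[1] (γ '' s) + 2 * ε * volume s := by
  have : ProperSpace F := FiniteDimensional.proper ℝ F
  have hemb : MeasurableEmbedding γ := by
    refine Topology.IsClosedEmbedding.measurableEmbedding ?_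
    refine AntilipschitzWith.isClosedEmbedding (K := 1) ?_ hγ.uniformContinuous
    refine AntilipschitzWith.of_le_mul_dist fun x y => ?_
    rw [Real.dist_eq, dist_eq_norm, NNReal.coe_one, one_mul]
    exact hγ' x y
  set D := {x | DifferentiableAt ℝ γ x} with hD
  have hDm : MeasurableSet D := measurableSet_of_differentiableAt ℝ γ
  have hD0 : volume Dᶜ = 0 := hγ.ae_differentiableAt_real
  have hsD : MeasurableSet (s ∩ D) := hs.inter hDm
  obtain ⟨t, A, htd, htm, hst, happ, -⟩ :=
    exists_partition_approximatesLinearOn_of_hasFDerivWithinAt γ (s ∩ D) (fderiv ℝ γ)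
      (fun x hx => hx.2.hasFDerivAt.hasFDerivWithinAt) (fun _ => ε) (fun _ => hε)
  have hpm : ∀ n, MeasurableSet (s ∩ D ∩ t n) := fun n => hsD.inter (htm n)
  have hpd : Pairwise (Function.onFun Disjoint fun n => s ∩ D ∩ t n) := fun i j hij =>
    (htd hij).mono inter_subset_right inter_subset_right
  have hU : s ∩ D = ⋃ n, s ∩ D ∩ t n := by
    rw [← inter_iUnion]; exact (inter_eq_left.2 hst).symm
  have hae : (s ∩ D : Set ℝ) =ᵐ[volume] s :=
    inter_ae_eq_left_of_ae_eq_univ (by rwa [ae_eq_univ])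
  -- The points of non-differentiability form a null set, which a Lipschitz map sends to a set of
  -- zero length. The images of the pieces are disjoint because `γ` is injective.
  have hH : μH[1] (γ '' s) = ∑' n, μH[1] (γ '' (s ∩ D ∩ t n)) := by
    have h1 : μH[1] (γ '' s) = μH[1] (γ '' (s ∩ D)) := by
      refine le_antisymm ?_ (measure_mono (image_mono inter_subset_left))
      have h0 : μH[1] (γ '' (Dᶜ)) = 0 := by
        have := hγ.hausdorffMeasure_image_le (d := 1) zero_le_one Dᶜ
        rw [hausdorffMeasure_real, hD0, mul_zero] at this
        exact le_antisymm this (bot_le)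
      calc μH[1] (γ '' s) ≤ μH[1] (γ '' (s ∩ D) ∪ γ '' Dᶜ) := by
            rw [← image_union]; refine measure_mono (image_mono fun x hx => ?_)
            by_cases h : x ∈ D
            · exact Or.inl ⟨hx, h⟩
            · exact Or.inr h
        _ ≤ _ := measure_union_le _ _
        _ = _ := by rw [h0, add_zero]
    rw [h1]
    conv_lhs => rw [hU]
    rw [image_iUnion, measure_iUnion]
    · intro i j hij
      exact (disjoint_image_iff hemb.injective).2 (hpd hij)
    · exact fun n => hemb.measurableSet_image.2 (hpm n)
  have hI : ∫⁻ x in s, ‖deriv γ x‖ₑ = ∑' n, ∫⁻ x in s ∩ D ∩ t n, ‖deriv γ x‖ₑ := by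
    rw [← setLIntegral_congr hae]
    conv_lhs => rw [hU]
    exact lintegral_iUnion hpm hpd _
  have hV : volume s = ∑' n, volume (s ∩ D ∩ t n) := by
    rw [← measure_congr hae]
    conv_lhs => rw [hU]
    exact measure_iUnion hpd hpm
  have hlin : ∀ n (x y : ℝ), ‖A n (x - y)‖ = ‖A n 1‖ * |x - y| := fun n x y => by
    have : A n (x - y) = (x - y) • A n 1 := by rw [← map_smul, smul_eq_mul, mul_one]
    rw [this, norm_smul, Real.norm_eq_abs, mul_comm]
  have hup : ∀ n, μH[1] (γ '' (s ∩ D ∩ t n)) ≤ (‖A n 1‖ₑ + ε) * volume (s ∩ D ∩ t n) := by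
    intro n
    have := hausdorffMeasure_image_le_mul_volume (γ := γ) (s := s ∩ D ∩ t n) (c := ‖A n 1‖₊ + ε)
      (fun x hx y hy => by
        have h1 := happ n x hx y hy
        have h2 := norm_le_norm_add_norm_sub' (γ x - γ y) (A n (x - y))
        rw [hlin] at h2
        rw [Real.norm_eq_abs] at h1
        push_cast
        linarith)
    simpa [enorm] using this
  have hlow : ∀ n, ‖A n 1‖ₑ * volume (s ∩ D ∩ t n)
      ≤ μH[1] (γ '' (s ∩ D ∩ t n)) + ε * volume (s ∩ D ∩ t n) := by
    intro n
    -- The subtraction is truncated: when ‖A 1‖ ≤ ε the expansion factor is 0 and the bound is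
    -- trivial.
    have := mul_volume_le_hausdorffMeasure_image (γ := γ) (s := s ∩ D ∩ t n) (c := ‖A n 1‖₊ - ε)
      (fun x hx y hy => by
        have h1 := happ n x hx y hy
        have h2 := norm_le_norm_add_norm_sub (γ x - γ y) (A n (x - y))
        rw [hlin] at h2
        rw [Real.norm_eq_abs] at h1
        rcases le_total ‖A n 1‖₊ ε with h3 | h3
        · simp [tsub_eq_zero_of_le h3]
        · rw [NNReal.coe_sub h3]
          push_cast
          linarith)
    calc ‖A n 1‖ₑ * volume (s ∩ D ∩ t n)
        ≤ (((‖A n 1‖₊ - ε : ℝ≥0) : ℝ≥0∞) + ε) * volume (s ∩ D ∩ t n) := by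
          gcongr
          rw [← ENNReal.coe_add, enorm]
          exact ENNReal.coe_le_coe.2 le_tsub_add
      _ ≤ _ := by rw [add_mul]; gcongr
  have hder : ∀ n, ∀ᵐ x ∂volume.restrict (s ∩ D ∩ t n), ‖deriv γ x - A n 1‖ ≤ ε := fun n =>
    ae_norm_deriv_sub_le_of_approximatesLinearOn (hpm n) (happ n) (fun x hx => hx.1.2)
  constructor
  · rw [hH, hI, hV, ← ENNReal.tsum_mul_left, ← ENNReal.tsum_add]
    refine ENNReal.tsum_le_tsum fun n => (hup n).trans ?_
    have h1 : ‖A n 1‖ₑ * volume (s ∩ D ∩ t n)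
        ≤ (∫⁻ x in s ∩ D ∩ t n, ‖deriv γ x‖ₑ) + ε * volume (s ∩ D ∩ t n) := by
      rw [← setLIntegral_const, ← setLIntegral_const, ← lintegral_add_right _ measurable_const]
      refine lintegral_mono_ae ?_
      filter_upwards [hder n] with x hx
      exact enorm_sub_enorm_le_coe (by rwa [norm_sub_rev])
    calc _ ≤ ((∫⁻ x in s ∩ D ∩ t n, ‖deriv γ x‖ₑ) + ε * volume (s ∩ D ∩ t n))
          + ε * volume (s ∩ D ∩ t n) := by rw [add_mul]; gcongr
      _ = _ := by ring
  · rw [hH, hI, hV, ← ENNReal.tsum_mul_left, ← ENNReal.tsum_add]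
    refine ENNReal.tsum_le_tsum fun n => ?_
    calc ∫⁻ x in s ∩ D ∩ t n, ‖deriv γ x‖ₑ ≤ ∫⁻ x in s ∩ D ∩ t n, (‖A n 1‖ₑ + ε) := by
          refine lintegral_mono_ae ?_
          filter_upwards [hder n] with x hx
          exact enorm_sub_enorm_le_coe hx
      _ = ‖A n 1‖ₑ * volume (s ∩ D ∩ t n) + ε * volume (s ∩ D ∩ t n) := by
          rw [setLIntegral_const, add_mul]
      _ ≤ _ := by
          refine (add_le_add_left (hlow n) _).trans (le_of_eq ?_)
          ring

/-- The area formula for a bi-Lipschitz curve. -/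
theorem hausdorffMeasure_restrict_range_eq_map [FiniteDimensional ℝ F] {γ : ℝ → F} {K : ℝ≥0}
    (hγ : LipschitzWith K γ) (hγ' : ∀ x y, |x - y| ≤ ‖γ x - γ y‖) :
    (μH[1] : Measure F).restrict (range γ)
      = (volume.withDensity fun x => ‖deriv γ x‖ₑ).map γ := by
  have : ProperSpace F := FiniteDimensional.proper ℝ F
  have hemb : MeasurableEmbedding γ := by
    refine Topology.IsClosedEmbedding.measurableEmbedding ?_
    refine AntilipschitzWith.isClosedEmbedding (K := 1) ?_ hγ.uniformContinuous
    refine AntilipschitzWith.of_le_mul_dist fun x y => ?_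
    rw [Real.dist_eq, dist_eq_norm, NNReal.coe_one, one_mul]
    exact hγ' x y
  -- It suffices to compare the pullback of Hausdorff measure with the density on bounded half-open
  -- intervals. There `ε` → 0 in the two-sided estimate, the error vanishing because the interval
  -- has finite length.
  rw [← hemb.map_comap]
  congr 1
  have hfin : ∀ a b : ℝ, a < b → μH[1] (γ '' Ioc a b) ≠ ⊤ := fun a b _ => by
    refine ne_top_of_le_ne_top ?_ (hγ.hausdorffMeasure_image_le (d := 1) zero_le_one _)
    rw [hausdorffMeasure_real, Real.volume_Ioc, ENNReal.rpow_one]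
    exact ENNReal.mul_ne_top coe_ne_top ofReal_ne_top
  refine Measure.ext_of_Ioc' _ _ ?_ ?_
  · intro a b hab
    rw [hemb.comap_apply]
    exact hfin a b hab
  · intro a b hab
    rw [hemb.comap_apply, withDensity_apply _ measurableSet_Ioc]
    have hv : volume (Ioc a b) ≠ ⊤ := by simp
    have key := fun ε : ℝ≥0 => hausdorffMeasure_image_approx hγ hγ' (s := Ioc a b)
      measurableSet_Ioc (ε := ε)
    have hlim : ∀ c : ℝ≥0∞, Tendsto (fun ε : ℝ≥0 => c + 2 * (ε : ℝ≥0∞) * volume (Ioc a b))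
        (𝓝[≠] 0) (𝓝 c) := by
      intro c
      have h1 : Tendsto (fun ε : ℝ≥0 => (ε : ℝ≥0∞)) (𝓝[≠] 0) (𝓝 0) := by
        have : Tendsto (fun ε : ℝ≥0 => (ε : ℝ≥0∞)) (𝓝 0) (𝓝 ((0 : ℝ≥0) : ℝ≥0∞)) :=
          ENNReal.tendsto_coe.2 tendsto_id
        exact this.mono_left nhdsWithin_le_nhds
      have h2 := ENNReal.Tendsto.mul_const (b := volume (Ioc a b))
        (ENNReal.Tendsto.const_mul (a := 2) h1 (Or.inr (by simp))) (Or.inr hv)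
      simpa using tendsto_const_nhds.add h2
    have hneb : (𝓝[≠] (0 : ℝ≥0)).NeBot := by
      infer_instance
    refine le_antisymm ?_ ?_
    · refine ge_of_tendsto (hlim _) ?_
      filter_upwards [self_mem_nhdsWithin] with ε hε using (key ε hε).1
    · refine ge_of_tendsto (hlim _) ?_
      filter_upwards [self_mem_nhdsWithin] with ε hε using (key ε hε).2

end Area

/-! ### Graph charts: closure, frontier and outward normal -/

section Chart

theorem coord_sq_add_sq (v : Plane) : v 0 ^ 2 + v 1 ^ 2 = ‖v‖ ^ 2 := by
  rw [EuclideanSpace.norm_sq_eq, Fin.sum_univ_two]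
  simp

theorem inner_plane (v w : Plane) : inner ℝ v w = v 0 * w 0 + v 1 * w 1 := by
  simp [PiLp.inner_apply, Fin.sum_univ_two, mul_comm]

theorem abs_coord_le_norm (v : Plane) (i : Fin 2) : |v i| ≤ ‖v‖ := by
  simpa using PiLp.norm_apply_le v i

/-- The curve parametrizing the graph of `f`. -/
noncomputable def graphCurve (f : ℝ → ℝ) (x : ℝ) : Plane := !₂[x, f x]

/-- The unit normal of the graph of `f`, pointing away from the subgraph. -/
noncomputable def graphNormal (f : ℝ → ℝ) (x : ℝ) : Plane :=
  (√(1 + deriv f x ^ 2))⁻¹ • !₂[-deriv f x, 1]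

/-- On the open set `U`, and in the coordinates given by the isometry `e`, the set `Ω` is the region
strictly below the graph of the Lipschitz function `f`. -/
structure IsGraphChart (Ω : Set Plane) (e : Plane ≃ₗᵢ[ℝ] Plane) (K : ℝ≥0) (f : ℝ → ℝ)
    (U : Set Plane) : Prop where
  lipschitz : LipschitzWith K f
  isOpen : IsOpen U
  mem_iff : ∀ y ∈ U, (y ∈ Ω ↔ (e y) 1 < f ((e y) 0))

theorem IsBoundedLipschitzDomain.exists_isGraphChart {Ω : Set Plane}
    (hΩ : IsBoundedLipschitzDomain Ω) {p : Plane} (hp : p ∈ closure Ω) :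
    ∃ e K f U, IsGraphChart Ω e K f U ∧ p ∈ U := by
  by_cases hpΩ : p ∈ Ω
  -- At an interior point `Ω` itself serves as the chart, with a constant graph lying above the
  -- bounded set. Interior and boundary points can then be treated alike.
  · obtain ⟨R, hR⟩ := hΩ.isBounded.exists_norm_le
    refine ⟨LinearIsometryEquiv.refl ℝ Plane, 0, fun _ => R + 1, Ω,
      ⟨LipschitzWith.const _, hΩ.isOpen, fun y hy => ⟨fun _ => ?_, fun _ => hy⟩⟩, hpΩ⟩
    have h1 := hR y hy
    have h2 := abs_coord_le_norm y 1
    have h3 := le_abs_self (y 1)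
    simp only [LinearIsometryEquiv.coe_refl, id]
    linarith
  · have : p ∈ frontier Ω := by rw [hΩ.isOpen.frontier_eq]; exact ⟨hp, hpΩ⟩
    obtain ⟨e, K, f, U, h1, h2, h3, h4⟩ := hΩ.exists_chart p this
    exact ⟨e, K, f, U, ⟨h1, h2, h4⟩, h3⟩

theorem continuous_coord (i : Fin 2) : Continuous fun y : Plane => y i := by fun_prop

theorem graphCurve_coords {f : ℝ → ℝ} {y : Plane} (h : y 1 = f (y 0)) : graphCurve f (y 0) = y := by
  ext i
  fin_cases i
  · simp [graphCurve]
  · simp [graphCurve, h]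

theorem norm_graphCurve_sub_le {f : ℝ → ℝ} {K : ℝ≥0} (hf : LipschitzWith K f) (x y : ℝ) :
    ‖graphCurve f x - graphCurve f y‖ ≤ (1 + K) * |x - y| := by
  have h1 := hf.dist_le_mul x y
  rw [Real.dist_eq, Real.dist_eq] at h1
  have h2 := coord_sq_add_sq (graphCurve f x - graphCurve f y)
  simp only [graphCurve, PiLp.sub_apply] at h2
  simp only [Matrix.cons_val_zero, Matrix.cons_val_one] at h2
  have h3 : |f x - f y| ^ 2 ≤ (K * |x - y|) ^ 2 := by gcongr
  refine abs_le_of_sq_le_sq' ?_ (by positivity) |>.2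
  rw [graphCurve, graphCurve, ← h2, ← sq_abs (f x - f y), ← sq_abs (x - y)]
  nlinarith [mul_nonneg (mul_nonneg K.2 (abs_nonneg (x - y))) (abs_nonneg (x - y)), h3,
    sq_nonneg |x - y|]

theorem le_norm_graphCurve_sub (f : ℝ → ℝ) (x y : ℝ) :
    |x - y| ≤ ‖graphCurve f x - graphCurve f y‖ := by
  simpa [graphCurve] using abs_coord_le_norm (graphCurve f x - graphCurve f y) 0

theorem hasDerivAt_graphCurve {f : ℝ → ℝ} {x : ℝ} (hf : DifferentiableAt ℝ f x) :
    HasDerivAt (graphCurve f) !₂[1, deriv f x] x := by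
  have h : HasDerivAt (fun x => ![x, f x]) ![1, deriv f x] x := by
    rw [hasDerivAt_pi]
    intro i
    fin_cases i
    · exact hasDerivAt_id' x
    · simpa using hf.hasDerivAt
  exact ((PiLp.continuousLinearEquiv 2 ℝ fun _ : Fin 2 =>
    ℝ).symm.toContinuousLinearMap.hasFDerivAt).comp_hasDerivAt x h

theorem sqrt_one_add_sq_pos (a : ℝ) : 0 < √(1 + a ^ 2) := Real.sqrt_pos.2 (by positivity)

theorem norm_deriv_graphCurve {f : ℝ → ℝ} {x : ℝ} (hf : DifferentiableAt ℝ f x) :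
    ‖deriv (graphCurve f) x‖ = √(1 + deriv f x ^ 2) := by
  rw [(hasDerivAt_graphCurve hf).deriv, EuclideanSpace.norm_eq, Fin.sum_univ_two]
  simp

variable {Ω : Set Plane} {e : Plane ≃ₗᵢ[ℝ] Plane} {K : ℝ≥0} {f : ℝ → ℝ} {U : Set Plane}

namespace IsGraphChart

/-- A point on or below the graph is a limit of points strictly below it, obtained by moving down in
the coordinates of `e`. Conversely, the closed region below the graph contains all limits of points
of `U ∩ Ω`. -/
theorem mem_closure_iff (h : IsGraphChart Ω e K f U) {y : Plane} (hy : y ∈ U) :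
    y ∈ closure Ω ↔ (e y) 1 ≤ f ((e y) 0) := by
  have hf := h.lipschitz.continuous
  have he := e.continuous
  constructor
  · intro hyc
    have h1 : y ∈ closure (U ∩ Ω) := by
      rw [mem_closure_iff_nhdsWithin_neBot] at hyc ⊢
      rwa [inter_comm, nhdsWithin_inter_of_mem' (mem_nhdsWithin_of_mem_nhds (h.isOpen.mem_nhds hy))]
    have hcl : IsClosed {y : Plane | (e y) 1 ≤ f ((e y) 0)} :=
      isClosed_le ((continuous_coord 1).comp he) (hf.comp ((continuous_coord 0).comp he))
    refine closure_minimal ?_ hcl h1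
    exact fun z hz => ((h.mem_iff z hz.1).1 hz.2).le
  · intro hle
    have ht : Tendsto (fun s : ℝ => y - s • e.symm (EuclideanSpace.single 1 1)) (𝓝[>] 0) (𝓝 y) := by
      refine Tendsto.mono_left ?_ nhdsWithin_le_nhds
      refine Continuous.tendsto' (by fun_prop) _ _ (by simp)
    refine mem_closure_of_tendsto ht ?_
    filter_upwards [self_mem_nhdsWithin, ht.eventually (h.isOpen.mem_nhds hy)] with s hs hU
    rw [h.mem_iff _ hU]
    simp
    linarith [hs.out]

theorem mem_frontier_iff (h : IsGraphChart Ω e K f U) (hΩ : IsOpen Ω) {y : Plane} (hy : y ∈ U) :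
    y ∈ frontier Ω ↔ (e y) 1 = f ((e y) 0) := by
  rw [hΩ.frontier_eq, Set.mem_sdiff, h.mem_closure_iff hy, h.mem_iff y hy, not_lt, le_antisymm_iff]

theorem frontier_inter (h : IsGraphChart Ω e K f U) (hΩ : IsOpen Ω) :
    frontier Ω ∩ U = range (fun x => e.symm (graphCurve f x)) ∩ U := by
  ext y
  constructor
  · rintro ⟨hy, hU⟩
    refine ⟨⟨(e y) 0, ?_⟩, hU⟩
    simp only
    rw [graphCurve_coords ((h.mem_frontier_iff hΩ hU).1 hy), e.symm_apply_apply]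
  · rintro ⟨⟨x, rfl⟩, hU⟩
    refine ⟨(h.mem_frontier_iff hΩ hU).2 ?_, hU⟩
    simp [graphCurve]

/-- The closure of `Ω` contains an open cone with vertex at any given point of a chart. -/
theorem uniqueDiffWithinAt (h : IsGraphChart Ω e K f U) {y : Plane} (hy : y ∈ U)
    (hyc : y ∈ closure Ω) : UniqueDiffWithinAt ℝ (closure Ω) y := by
  have hle := (h.mem_closure_iff hy).1 hyc
  -- The downward open cone of slope `K` at `y`: because `f` is `K`-Lipschitz, the cone stays below
  -- the graph. It is convex and open with `y` in its closure, which gives unique differentiability.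
  set C : Set Plane := {z | (e (z - y)) 1 + K * |(e (z - y)) 0| < 0} with hC
  have hCo : IsOpen C := by
    refine isOpen_lt ?_ continuous_const
    have := e.continuous
    fun_prop
  have hCc : Convex ℝ C := by
    intro a ha b hb s t hs ht hst
    have hz : s • a + t • b - y = s • (a - y) + t • (b - y) := by
      rw [smul_sub, smul_sub, ← sub_eq_zero]
      have : y = s • y + t • y := by rw [← add_smul, hst, one_smul]
      nth_rewrite 1 [this]
      abel
    simp only [hC, mem_ofPred_eq] at ha hb ⊢
    rw [hz, map_add, map_smul, map_smul]
    simp only [PiLp.add_apply, PiLp.smul_apply, smul_eq_mul]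
    have h1 : |s * (e (a - y)) 0 + t * (e (b - y)) 0|
        ≤ s * |(e (a - y)) 0| + t * |(e (b - y)) 0| := by
      refine (abs_add_le _ _).trans (le_of_eq ?_)
      rw [abs_mul, abs_mul, abs_of_nonneg hs, abs_of_nonneg ht]
    have h2 := mul_le_mul_of_nonneg_left h1 K.2
    rw [NNReal.val_eq_coe] at h2
    rcases hs.eq_or_lt with rfl | hs'
    · have : t = 1 := by linarith
      subst this
      simpa using hb
    · nlinarith [mul_neg_of_pos_of_neg hs' ha, mul_nonpos_of_nonneg_of_nonpos ht hb.le]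
  have ht : Tendsto (fun s : ℝ => y - s • e.symm (EuclideanSpace.single 1 1)) (𝓝[>] 0) (𝓝 y) := by
    refine Tendsto.mono_left ?_ nhdsWithin_le_nhds
    refine Continuous.tendsto' (by fun_prop) _ _ (by simp)
  have hmem : ∀ s : ℝ, 0 < s → y - s • e.symm (EuclideanSpace.single 1 1) ∈ C := by
    intro s hs
    simp [hC, hs]
  have hycl : y ∈ closure C := by
    refine mem_closure_of_tendsto ht ?_
    filter_upwards [self_mem_nhdsWithin] with s hs using hmem s hs
  have h1 : UniqueDiffWithinAt ℝ C y := by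
    refine uniqueDiffWithinAt_convex hCc ?_ hycl
    rw [hCo.interior_eq]
    exact ⟨_, hmem 1 one_pos⟩
  refine (h1.inter (h.isOpen.mem_nhds hy)).mono ?_
  rintro z ⟨hz, hzU⟩
  refine subset_closure ((h.mem_iff z hzU).2 ?_)
  have h2 := h.lipschitz.dist_le_mul ((e z) 0) ((e y) 0)
  rw [Real.dist_eq, Real.dist_eq] at h2
  simp only [hC, mem_ofPred_eq, map_sub, PiLp.sub_apply] at hz
  linarith [neg_abs_le (f ((e z) 0) - f ((e y) 0))]

end IsGraphChart

theorem IsBoundedLipschitzDomain.uniqueDiffOn_closure (hΩ : IsBoundedLipschitzDomain Ω) :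
    UniqueDiffOn ℝ (closure Ω) := by
  intro y hy
  obtain ⟨e, K, f, U, h, hU⟩ := hΩ.exists_isGraphChart hy
  exact h.uniqueDiffWithinAt hU hy

/-- Move from `x` in the direction ν' - ν, which points strictly inward for ν and strictly outward
for ν'. A nearby point on this ray contradicts the condition for ν' if it lies in `Ω`, and the
condition for ν if it does not. -/
theorem IsOutwardUnitNormal.unique {x ν ν' : Plane} (h : IsOutwardUnitNormal Ω x ν)
    (h' : IsOutwardUnitNormal Ω x ν') : ν = ν' := by
  by_contra hne
  have hlt : inner ℝ ν' ν < 1 := by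
    refine lt_of_le_of_ne ?_ fun heq => hne ?_
    · simpa [h.1, h'.1] using real_inner_le_norm ν' ν
    · exact ((inner_eq_one_iff_of_norm_eq_one h'.1 h.1).1 heq).symm
  set v := ν' - ν with hv
  set c := 1 - inner ℝ ν' ν with hc
  have hcpos : 0 < c := by linarith
  have hv1 : inner ℝ v ν = -c := by
    rw [hv, inner_sub_left, real_inner_self_eq_norm_sq, h.1]; ring
  have hv2 : inner ℝ v ν' = c := by
    rw [hv, inner_sub_left, real_inner_self_eq_norm_sq, h'.1, real_inner_comm]; ring
  have hvn : 0 < ‖v‖ := norm_pos_iff.2 (sub_ne_zero.2 (Ne.symm hne))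
  set ε := c / (2 * ‖v‖) with hε
  have hεpos : 0 < ε := by positivity
  have hεv : ε * ‖v‖ = c / 2 := by rw [hε]; field_simp
  have ht : Tendsto (fun s : ℝ => x + s • v) (𝓝[>] 0) (𝓝 x) := by
    refine Tendsto.mono_left ?_ nhdsWithin_le_nhds
    exact Continuous.tendsto' (by fun_prop) _ _ (by simp)
  have := (ht.eventually (h.2 ε hεpos)).and ((ht.eventually (h'.2 ε hεpos)).and
    self_mem_nhdsWithin)
  obtain ⟨s, hs1, hs2, hs3⟩ := this.exists
  have hs3' : (0 : ℝ) < s := hs3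
  simp only [add_sub_cancel_left, inner_smul_left, norm_smul, Real.norm_eq_abs,
    abs_of_pos hs3', hv1, hv2, conj_trivial] at hs1 hs2
  have hmul : ε * (s * ‖v‖) = s * (c / 2) := by rw [← hεv]; ring
  rw [hmul] at hs1 hs2
  have := mul_pos hs3' hcpos
  by_cases hmem : x + s • v ∈ Ω
  · linarith [hs2.1 hmem]
  · linarith [hs1.2 hmem]

theorem IsOutwardUnitNormal.outwardNormal_eq {x ν : Plane} (h : IsOutwardUnitNormal Ω x ν) :
    outwardNormal Ω x = ν := by
  have hex : ∃ ν, IsOutwardUnitNormal Ω x ν := ⟨ν, h⟩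
  rw [outwardNormal, dif_pos hex]
  exact hex.choose_spec.unique h

theorem norm_graphNormal (f : ℝ → ℝ) (x : ℝ) : ‖graphNormal f x‖ = 1 := by
  have h := sqrt_one_add_sq_pos (deriv f x)
  have h1 : ‖(!₂[-deriv f x, 1] : Plane)‖ = √(1 + deriv f x ^ 2) := by
    rw [EuclideanSpace.norm_eq, Fin.sum_univ_two]
    simp [add_comm]
  rw [graphNormal, norm_smul, h1, norm_inv, Real.norm_eq_abs, abs_of_pos h, inv_mul_cancel₀ h.ne']

/-- The inner product of `z - y` with the graph normal is the height of `z` above the tangent line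
divided by √(1 + f'²). The tangent line differs from the graph by o(|z - y|), and the divisor is at
least 1. -/
theorem IsGraphChart.isOutwardUnitNormal (h : IsGraphChart Ω e K f U) {y : Plane} (hy : y ∈ U)
    (hyf : (e y) 1 = f ((e y) 0)) (hd : DifferentiableAt ℝ f ((e y) 0)) :
    IsOutwardUnitNormal Ω y (e.symm (graphNormal f ((e y) 0))) := by
  refine ⟨by rw [e.symm.norm_map, norm_graphNormal], fun ε hε => ?_⟩
  set r := √(1 + deriv f ((e y) 0) ^ 2) with hr
  have hr1 : 1 ≤ r := Real.one_le_sqrt.2 (by nlinarith [sq_nonneg (deriv f ((e y) 0))])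
  have hr0 : 0 < r := by linarith
  have hlo := hd.hasDerivAt.isLittleO
  have hlo' := hlo.def hε
  have ht : Tendsto (fun z : Plane => (e z) 0) (𝓝 y) (𝓝 ((e y) 0)) :=
    ((continuous_coord 0).comp e.continuous).tendsto y
  filter_upwards [ht.eventually hlo', h.isOpen.mem_nhds hy] with z hz hzU
  have hin : inner ℝ (z - y) (e.symm (graphNormal f ((e y) 0)))
      = r⁻¹ * (((e z) 1 - (e y) 1) - deriv f ((e y) 0) * ((e z) 0 - (e y) 0)) := by
    rw [← e.inner_map_map, e.apply_symm_apply, inner_plane]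
    simp [graphNormal, ← hr]
    ring
  have hz' : |f ((e z) 0) - f ((e y) 0) - deriv f ((e y) 0) * ((e z) 0 - (e y) 0)|
      ≤ ε * ‖z - y‖ := by
    rw [Real.norm_eq_abs, Real.norm_eq_abs, smul_eq_mul, mul_comm ((e z) 0 - _)] at hz
    refine hz.trans ?_
    gcongr
    have := abs_coord_le_norm (e (z - y)) 0
    rwa [e.norm_map, map_sub, PiLp.sub_apply] at this
  have hp : 0 ≤ ε * ‖z - y‖ := by positivity
  rw [hin, inv_mul_le_iff₀ hr0, ← mul_inv_le_iff₀' (inv_pos.2 hr0), inv_inv]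
  rw [h.mem_iff z hzU]
  constructor
  · intro hlt
    nlinarith [(abs_le.1 hz').2]
  · intro hge
    nlinarith [(abs_le.1 hz').1]

/-! ### Arc length on the boundary in a chart -/

section ArcLength

variable (e f)

theorem lipschitzWith_chartCurve (hf : LipschitzWith K f) :
    LipschitzWith (1 + K) fun x => e.symm (graphCurve f x) := by
  refine LipschitzWith.of_dist_le_mul fun x y => ?_
  rw [e.symm.dist_map, Real.dist_eq, dist_eq_norm]
  exact norm_graphCurve_sub_le hf x y

theorem measurableEmbedding_chartCurve (hf : LipschitzWith K f) :
    MeasurableEmbedding fun x => e.symm (graphCurve f x) := by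
  refine Topology.IsClosedEmbedding.measurableEmbedding ?_
  refine AntilipschitzWith.isClosedEmbedding (K := 1) ?_
    (lipschitzWith_chartCurve e f hf).uniformContinuous
  refine AntilipschitzWith.of_le_mul_dist fun x y => ?_
  rw [Real.dist_eq, e.symm.dist_map, dist_eq_norm, NNReal.coe_one, one_mul]
  exact le_norm_graphCurve_sub f x y

theorem norm_deriv_chartCurve {x : ℝ} (hf : DifferentiableAt ℝ f x) :
    ‖deriv (fun x => e.symm (graphCurve f x)) x‖ = √(1 + deriv f x ^ 2) := by
  have := (e.symm.toContinuousLinearEquiv.toContinuousLinearMap.hasFDerivAt).comp_hasDerivAt x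
    (hasDerivAt_graphCurve hf)
  rw [HasDerivAt.deriv (f := fun x => e.symm (graphCurve f x)) this]
  simp only [ContinuousLinearEquiv.coe_coe, LinearIsometryEquiv.coe_toContinuousLinearEquiv,
    LinearIsometryEquiv.norm_map]
  rw [← norm_deriv_graphCurve hf, (hasDerivAt_graphCurve hf).deriv]

theorem hausdorffMeasure_restrict_graph (hf : LipschitzWith K f) :
    (μH[1] : Measure Plane).restrict (range fun x => e.symm (graphCurve f x))
      = (volume.withDensity fun x => (Real.toNNReal √(1 + deriv f x ^ 2) : ENNReal)).map
        fun x => e.symm (graphCurve f x) := by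
  rw [hausdorffMeasure_restrict_range_eq_map (lipschitzWith_chartCurve e f hf)]
  · congr 1
    refine withDensity_congr_ae ?_
    filter_upwards [hf.ae_differentiableAt_real] with x hx
    rw [← norm_deriv_chartCurve e f hx, norm_toNNReal]
    rfl
  · intro x y
    rw [← map_sub, e.symm.norm_map]
    exact le_norm_graphCurve_sub f x y

variable {e f}

theorem IsGraphChart.arcLength_restrict (h : IsGraphChart Ω e K f U) (hΩ : IsOpen Ω) :
    (arcLength Ω).restrict U = ((volume.withDensity fun x =>
      (Real.toNNReal √(1 + deriv f x ^ 2) : ENNReal)).map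
        fun x => e.symm (graphCurve f x)).restrict U := by
  rw [← hausdorffMeasure_restrict_graph e f h.lipschitz, arcLength,
    Measure.restrict_restrict h.isOpen.measurableSet,
    Measure.restrict_restrict h.isOpen.measurableSet, inter_comm, h.frontier_inter hΩ, inter_comm]

theorem measurable_toNNReal_sqrt_deriv (f : ℝ → ℝ) :
    Measurable fun x => Real.toNNReal √(1 + deriv f x ^ 2) := by
  have := measurable_deriv f
  fun_prop

/-- The graph follows the boundary only inside `U`; the vanishing of `G` elsewhere permits
integration over the whole real line. -/
theorem IsGraphChart.integrable_arcLength_iff (h : IsGraphChart Ω e K f U) (hΩ : IsOpen Ω)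
    {G : Plane → ℝ} (hG : ∀ y ∉ U, G y = 0) :
    Integrable G (arcLength Ω) ↔
      Integrable fun x => √(1 + deriv f x ^ 2) * G (e.symm (graphCurve f x)) := by
  have hsupp : Function.support G ⊆ U := fun y hy => by
    by_contra hyU; exact hy (hG y hyU)
  rw [← integrableOn_iff_integrable_of_support_subset hsupp, IntegrableOn,
    h.arcLength_restrict hΩ, ← IntegrableOn, integrableOn_iff_integrable_of_support_subset hsupp,
    (measurableEmbedding_chartCurve e f h.lipschitz).integrable_map_iff,
    integrable_withDensity_iff_integrable_smul (measurable_toNNReal_sqrt_deriv f)]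
  simp [NNReal.smul_def]

theorem IsGraphChart.integral_arcLength (h : IsGraphChart Ω e K f U) (hΩ : IsOpen Ω)
    {G : Plane → ℝ} (hG : ∀ y ∉ U, G y = 0) :
    ∫ y, G y ∂arcLength Ω = ∫ x, √(1 + deriv f x ^ 2) * G (e.symm (graphCurve f x)) := by
  rw [← setIntegral_eq_integral_of_forall_compl_eq_zero hG, h.arcLength_restrict hΩ,
    setIntegral_eq_integral_of_forall_compl_eq_zero hG,
    (measurableEmbedding_chartCurve e f h.lipschitz).integral_map,
    integral_withDensity_eq_integral_smul (measurable_toNNReal_sqrt_deriv f)]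
  simp [NNReal.smul_def]

/-- Rademacher's theorem makes `f` differentiable almost everywhere, and in the chart arc length is
the image of a measure absolutely continuous with respect to `dx`. -/
theorem IsGraphChart.ae_isOutwardUnitNormal (h : IsGraphChart Ω e K f U) (hΩ : IsOpen Ω) :
    ∀ᵐ y ∂(arcLength Ω).restrict U, IsOutwardUnitNormal Ω y (outwardNormal Ω y) := by
  rw [h.arcLength_restrict hΩ, ae_restrict_iff' h.isOpen.measurableSet,
    (measurableEmbedding_chartCurve e f h.lipschitz).ae_map_iff]
  refine (withDensity_absolutelyContinuous _ _).ae_le ?_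
  filter_upwards [h.lipschitz.ae_differentiableAt_real] with x hx hU
  have := h.isOutwardUnitNormal hU (by simp [graphCurve]) (by simpa [graphCurve] using hx)
  rwa [this.outwardNormal_eq]

theorem IsBoundedLipschitzDomain.ae_isOutwardUnitNormal (hΩ : IsBoundedLipschitzDomain Ω) :
    ∀ᵐ y ∂arcLength Ω, IsOutwardUnitNormal Ω y (outwardNormal Ω y) := by
  choose! e K f U h hU using fun p (hp : p ∈ closure Ω) => hΩ.exists_isGraphChart hp
  obtain ⟨t, htc, ht, hcov⟩ := TopologicalSpace.countable_cover_nhdsWithin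
    (f := fun p => U p) (s := closure Ω)
    fun p hp => mem_nhdsWithin_of_mem_nhds ((h p hp).isOpen.mem_nhds (hU p hp))
  have h1 : ∀ᵐ y ∂(arcLength Ω).restrict (⋃ p ∈ t, U p),
      IsOutwardUnitNormal Ω y (outwardNormal Ω y) := by
    rw [ae_restrict_biUnion_iff _ ht]
    exact fun p hp => (h p (htc hp)).ae_isOutwardUnitNormal hΩ.isOpen
  have h2 : (arcLength Ω).restrict (⋃ p ∈ t, U p) = arcLength Ω := by
    have ho : IsOpen (⋃ p ∈ t, U p) := isOpen_biUnion fun p hp => (h p (htc hp)).isOpen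
    rw [arcLength, Measure.restrict_restrict ho.measurableSet,
      inter_eq_right.2 (frontier_subset_closure.trans hcov)]
  rwa [h2] at h1

end ArcLength

end Chart

/-! ### Divergence theorem below a Lipschitz graph -/

section Subgraph

theorem integrableOn_of_bounded_of_vanishing {X : Type*} [TopologicalSpace X] [MeasurableSpace X]
    [OpensMeasurableSpace X] [SecondCountableTopology X] {m : Measure X}
    {F : X → ℝ} {A B : Set X} {M : ℝ}
    (hA : MeasurableSet A) (hB : MeasurableSet B) (hBm : m B ≠ ⊤) (hF : ContinuousOn F A)
    (hM : ∀ x ∈ A, |F x| ≤ M) (h0 : ∀ x ∈ A, x ∉ B → F x = 0) : IntegrableOn F A m := by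
  have hint : Integrable (B.indicator fun _ => M) (m.restrict A) := by
    refine (integrable_indicator_iff hB).2 ?_
    refine integrableOn_const ?_
    exact ne_top_of_le_ne_top hBm (Measure.restrict_apply_le _ _)
  refine hint.mono' (hF.aestronglyMeasurable hA) ?_
  refine (ae_restrict_iff' hA).2 (Eventually.of_forall fun x hx => ?_)
  by_cases hxB : x ∈ B
  · rw [indicator_of_mem hxB]; exact hM x hx
  · rw [indicator_of_notMem hxB, h0 x hx hxB, norm_zero]

/-- The plane in the coordinates `(x, y - f x)`, in which the graph of `f` is a line. -/
noncomputable def shear (f : ℝ → ℝ) (p : ℝ × ℝ) : Plane := !₂[p.1, f p.1 + p.2]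

variable {f : ℝ → ℝ}

@[simp] theorem shear_apply_zero (p : ℝ × ℝ) : shear f p 0 = p.1 := by simp [shear]

@[simp] theorem shear_apply_one (p : ℝ × ℝ) : shear f p 1 = f p.1 + p.2 := by simp [shear]

theorem continuous_shear (hf : Continuous f) : Continuous (shear f) := by
  unfold shear
  refine (PiLp.continuous_toLp 2 _).comp ?_
  refine continuous_pi fun i => ?_
  fin_cases i
  · exact continuous_fst
  · exact (hf.comp continuous_fst).add continuous_snd

/-- The change of coordinates `shear f` as a homeomorphism. -/
noncomputable def shearHomeomorph (hf : Continuous f) : ℝ × ℝ ≃ₜ Plane where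
  toFun := shear f
  invFun y := (y 0, y 1 - f (y 0))
  left_inv p := by simp
  right_inv y := by
    ext i
    fin_cases i <;> simp
  continuous_toFun := continuous_shear hf
  continuous_invFun := by fun_prop

/-- Each vertical line is merely translated by `f x`, so Fubini suffices and no Jacobian of `f` is
needed. -/
theorem measurePreserving_shear (hf : Continuous f) : MeasurePreserving (shear f) := by
  have h1 : MeasurePreserving (fun p : ℝ × ℝ => (p.1, f p.1 + p.2))
      (volume.prod volume) (volume.prod volume) := by
    refine (MeasurePreserving.id volume).skew_product (g := fun x y => f x + y) ?_ ?_
    · exact (by fun_prop : Continuous fun p : ℝ × ℝ => f p.1 + p.2).measurable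
    · exact Eventually.of_forall fun x => map_add_left_eq_self volume (f x)
  have h2 := (PiLp.volume_preserving_toLp (Fin 2)).comp
    ((volume_preserving_finTwoArrow ℝ).symm.comp h1)
  exact h2

theorem measurableEmbedding_shear (hf : Continuous f) : MeasurableEmbedding (shear f) :=
  (shearHomeomorph hf).measurableEmbedding

theorem hasDerivAt_shear_snd (x z : ℝ) :
    HasDerivAt (fun s => shear f (x, s)) (EuclideanSpace.single 1 1) z := by
  have h : HasDerivAt (fun s => ![x, f x + s]) ![0, 1] z := by
    rw [hasDerivAt_pi]
    intro i
    fin_cases i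
    · exact hasDerivAt_const z x
    · exact (hasDerivAt_id' z).const_add (f x)
  have h2 := ((PiLp.continuousLinearEquiv 2 ℝ fun _ : Fin 2 =>
    ℝ).symm.toContinuousLinearMap.hasFDerivAt).comp_hasDerivAt z h
  convert! h2 using 1
  ext i
  fin_cases i <;> simp

theorem hasDerivAt_shear_fst {x : ℝ} (z : ℝ) (hf : DifferentiableAt ℝ f x) :
    HasDerivAt (fun s => shear f (s, z))
      (EuclideanSpace.single 0 1 + deriv f x • EuclideanSpace.single 1 1) x := by
  have h : HasDerivAt (fun s => ![s, f s + z]) ![1, deriv f x] x := by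
    rw [hasDerivAt_pi]
    intro i
    fin_cases i
    · exact hasDerivAt_id' x
    · exact hf.hasDerivAt.add_const z
  have h2 := ((PiLp.continuousLinearEquiv 2 ℝ fun _ : Fin 2 =>
    ℝ).symm.toContinuousLinearMap.hasFDerivAt).comp_hasDerivAt x h
  convert! h2 using 1
  ext i
  fin_cases i <;> simp

/-- The integral over the real line of the derivative of a locally Lipschitz function vanishing
outside a bounded interval. -/
theorem integral_deriv_eq_zero_of_locallyLipschitz {k : ℝ → ℝ} {R : ℝ} (hk : LocallyLipschitz k)
    (h0 : ∀ x, R < |x| → k x = 0) : ∫ x, deriv k x = 0 := by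
  -- On a compact interval `k` is Lipschitz, hence absolutely continuous, and the fundamental
  -- theorem applies. The endpoints ±(|R| + 1) lie where `k` vanishes, even if `R` is negative.
  obtain ⟨L, hL⟩ := (hk.locallyLipschitzOn (s := uIcc (-(|R| + 1)) (|R| + 1))
    ).exists_lipschitzOnWith_of_compact isCompact_uIcc
  have h1 := hL.absolutelyContinuousOnInterval.integral_deriv_eq_sub
  have hR := le_abs_self R
  rw [h0 (|R| + 1) (by rw [abs_of_nonneg (by positivity)]; linarith),
    h0 (-(|R| + 1)) (by rw [abs_neg, abs_of_nonneg (by positivity)]; linarith), sub_zero,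
    intervalIntegral.integral_of_le (by linarith [abs_nonneg R])] at h1
  rw [← h1, setIntegral_eq_integral_of_forall_compl_eq_zero]
  intro x hx
  have hx' : R < |x| := by
    by_contra! hle
    refine hx ⟨?_, ?_⟩ <;> linarith [neg_abs_le x, le_abs_self x]
  have : k =ᶠ[𝓝 x] fun _ => 0 := by
    filter_upwards [(isOpen_lt continuous_const continuous_abs).mem_nhds hx'] with y hy using h0 y hy
  rw [this.deriv_eq, deriv_const]

/-- A function on the closed subgraph of `f` with bounded support, continuous up to the graph and
continuously differentiable with bounded derivative below it. -/
structure IsSubgraphTest (f : ℝ → ℝ) (h : Plane → ℝ) (M R : ℝ) : Prop where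
  continuousOn : ContinuousOn h {y | y 1 ≤ f (y 0)}
  contDiffOn : ContDiffOn ℝ 1 h {y | y 1 < f (y 0)}
  norm_fderiv_le : ∀ y : Plane, y 1 < f (y 0) → ‖fderiv ℝ h y‖ ≤ M
  eq_zero : ∀ y : Plane, R < ‖y‖ → h y = 0

variable {K : ℝ≥0} {h : Plane → ℝ} {M R : ℝ}

theorem isOpen_subgraph (hf : Continuous f) : IsOpen {y : Plane | y 1 < f (y 0)} :=
  isOpen_lt (continuous_coord 1) (hf.comp (continuous_coord 0))

namespace IsSubgraphTest

theorem hasFDerivAt (hh : IsSubgraphTest f h M R) (hf : Continuous f) {y : Plane}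
    (hy : y 1 < f (y 0)) : HasFDerivAt h (fderiv ℝ h y) y :=
  ((hh.contDiffOn.differentiableOn one_ne_zero).differentiableAt
    ((isOpen_subgraph hf).mem_nhds hy)).hasFDerivAt

theorem fderiv_eq_zero (hh : IsSubgraphTest f h M R) {y : Plane} (hy : R < ‖y‖) :
    fderiv ℝ h y = 0 := by
  have : h =ᶠ[𝓝 y] fun _ => 0 := by
    filter_upwards [(isOpen_lt continuous_const continuous_norm).mem_nhds hy] with z hz
      using hh.eq_zero z hz
  rw [this.fderiv_eq, fderiv_fun_const, Pi.zero_apply]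

theorem continuousOn_fderiv (hh : IsSubgraphTest f h M R) (hf : Continuous f) (v : Plane) :
    ContinuousOn (fun y => fderiv ℝ h y v) {y | y 1 < f (y 0)} :=
  (hh.contDiffOn.continuousOn_fderiv_of_isOpen (isOpen_subgraph hf) le_rfl).clm_apply
    continuousOn_const

theorem abs_fderiv_apply_le (hh : IsSubgraphTest f h M R) (v : Plane) {y : Plane}
    (hy : y 1 < f (y 0)) : |fderiv ℝ h y v| ≤ M * ‖v‖ :=
  ((fderiv ℝ h y).le_opNorm v).trans
    (mul_le_mul_of_nonneg_right (hh.norm_fderiv_le y hy) (norm_nonneg v))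

theorem integrableOn_fderiv (hh : IsSubgraphTest f h M R) (hf : Continuous f) (v : Plane) :
    IntegrableOn (fun y => fderiv ℝ h y v) {y | y 1 < f (y 0)} := by
  refine integrableOn_of_bounded_of_vanishing (isOpen_subgraph hf).measurableSet
    (Metric.isClosed_closedBall (x := (0 : Plane)) (ε := R)).measurableSet
    measure_closedBall_lt_top.ne (hh.continuousOn_fderiv hf v)
    (fun y hy => hh.abs_fderiv_apply_le v hy) fun y _ hy => ?_
  rw [hh.fderiv_eq_zero (by simpa using hy), _root_.zero_apply]

theorem integrableOn_fderiv_shear (hh : IsSubgraphTest f h M R) (hf : Continuous f) (v : Plane) :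
    Integrable (fun p : ℝ × ℝ => fderiv ℝ h (shear f p) v)
      (volume.prod (volume.restrict (Iio 0))) := by
  have h1 := ((measurePreserving_shear hf).integrableOn_comp_preimage
    (measurableEmbedding_shear hf)).2 (hh.integrableOn_fderiv hf v)
  have h2 : shear f ⁻¹' {y | y 1 < f (y 0)} = univ ×ˢ Iio 0 := by
    ext p; simp
  rw [h2, IntegrableOn, Measure.volume_eq_prod, ← Measure.prod_restrict,
    Measure.restrict_univ] at h1
  exact h1

theorem setIntegral_fderiv_eq (hh : IsSubgraphTest f h M R) (hf : Continuous f) (v : Plane) :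
    ∫ y in {y : Plane | y 1 < f (y 0)}, fderiv ℝ h y v
      = ∫ x, ∫ z in Iio 0, fderiv ℝ h (shear f (x, z)) v := by
  have h1 := (measurePreserving_shear hf).setIntegral_preimage_emb (measurableEmbedding_shear hf)
    (fun y => fderiv ℝ h y v) {y | y 1 < f (y 0)}
  have h2 : shear f ⁻¹' {y | y 1 < f (y 0)} = univ ×ˢ Iio 0 := by
    ext p; simp
  rw [← h1, h2, Measure.volume_eq_prod, ← Measure.prod_restrict, Measure.restrict_univ,
    integral_prod _ (hh.integrableOn_fderiv_shear hf v)]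

/-- Fundamental theorem of calculus on a vertical half-line: `h` is continuous up to the graph and
vanishes far below it. -/
theorem setIntegral_fderiv_vertical (hh : IsSubgraphTest f h M R) (hf : Continuous f) (x : ℝ) :
    ∫ z in Iio 0, fderiv ℝ h (shear f (x, z)) (EuclideanSpace.single 1 1)
      = h (graphCurve f x) := by
  have hs : Continuous fun z => shear f (x, z) := (continuous_shear hf).comp (by fun_prop)
  have hfar : ∀ z : ℝ, z < -(|R| + |f x|) → R < ‖shear f (x, z)‖ := by
    intro z hz
    have h1 := abs_coord_le_norm (shear f (x, z)) 1
    rw [shear_apply_one] at h1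
    have := neg_abs_le (f x + z)
    linarith [le_abs_self (f x), le_abs_self R]
  rw [← integral_Iic_eq_integral_Iio, integral_Iic_of_hasDerivAt_of_tendsto
    (f := fun z => h (shear f (x, z))) (m := 0)]
  · simp [shear, graphCurve]
  · refine ContinuousWithinAt.comp (t := {y : Plane | y 1 ≤ f (y 0)}) ?_
      hs.continuousWithinAt ?_
    · exact hh.continuousOn _ (by simp)
    · intro z hz; simpa using hz
  · intro z hz
    exact (hh.hasFDerivAt hf (by simpa using hz)).comp_hasDerivAt z (hasDerivAt_shear_snd x z)
  · rw [integrableOn_Iic_iff_integrableOn_Iio]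
    refine integrableOn_of_bounded_of_vanishing measurableSet_Iio
      (measurableSet_Icc (a := -(|R| + |f x|)) (b := (0 : ℝ))) (by simp) ?_
      (M := M * ‖(EuclideanSpace.single 1 1 : Plane)‖) ?_ ?_
    · refine (hh.continuousOn_fderiv hf _).comp hs.continuousOn ?_
      intro z hz; simpa using hz
    · intro z hz
      exact hh.abs_fderiv_apply_le _ (by simpa using hz)
    · intro z hz hz'
      rw [hh.fderiv_eq_zero, _root_.zero_apply]
      refine hfar z ?_
      by_contra! hle
      exact hz' ⟨hle, (le_of_lt hz)⟩
  · refine tendsto_const_nhds.congr' ?_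
    filter_upwards [eventually_lt_atBot (-(|R| + |f x|))] with z hz
    exact (hh.eq_zero _ (hfar z hz)).symm

/-- The integrand is almost everywhere the derivative of x ↦ h(x, f x + z). At fixed depth z < 0 the
shifted graph lies in the open region where `h` is C¹, so this function is locally Lipschitz, and it
has bounded support. -/
theorem integral_fderiv_tangential (hh : IsSubgraphTest f h M R) (hf : LipschitzWith K f) {z : ℝ}
    (hz : z < 0) :
    ∫ x, (fderiv ℝ h (shear f (x, z)) (EuclideanSpace.single 0 1)
      + deriv f x * fderiv ℝ h (shear f (x, z)) (EuclideanSpace.single 1 1)) = 0 := by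
  have hLip : LipschitzWith (1 + K) fun x => shear f (x, z) := by
    refine LipschitzWith.of_dist_le_mul fun x y => ?_
    have h1 := norm_graphCurve_sub_le hf x y
    have h2 : shear f (x, z) - shear f (y, z) = graphCurve f x - graphCurve f y := by
      ext i; fin_cases i <;> simp [graphCurve]
    rw [dist_eq_norm, h2, Real.dist_eq]
    exact_mod_cast h1
  have hmem : ∀ x, shear f (x, z) ∈ {y : Plane | y 1 < f (y 0)} := fun x => by simpa using hz
  have hk : LocallyLipschitz fun x => h (shear f (x, z)) := by
    intro x
    obtain ⟨L, t, ht, hL⟩ := (hh.contDiffOn.contDiffAt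
      ((isOpen_subgraph hf.continuous).mem_nhds (hmem x))).exists_lipschitzOnWith
    refine ⟨L * (1 + K), _, hLip.continuous.continuousAt.preimage_mem_nhds ht, ?_⟩
    exact hL.comp hLip.lipschitzOnWith (mapsTo_preimage _ _)
  rw [← integral_deriv_eq_zero_of_locallyLipschitz (R := R) hk fun x hx => hh.eq_zero _ ?_]
  · refine integral_congr_ae ?_
    filter_upwards [hf.ae_differentiableAt_real] with x hx
    have h1 := (hh.hasFDerivAt hf.continuous (hmem x)).comp_hasDerivAt x
      (hasDerivAt_shear_fst z hx)
    rw [HasDerivAt.deriv (f := fun x => h (shear f (x, z))) h1, map_add, map_smul, smul_eq_mul]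
  · have := abs_coord_le_norm (shear f (x, z)) 0
    rw [shear_apply_zero] at this
    exact hx.trans_le this

theorem abs_deriv_le (hf : LipschitzWith K f) (x : ℝ) : |deriv f x| ≤ K :=
  norm_deriv_le_of_lipschitz hf

/-- Write ∂₀h as the derivative along the shifted graph minus f' ∂₁h. Integrating first in `x`
removes the former; integrating first in `z` evaluates the latter on the graph. -/
theorem setIntegral_fderiv_horizontal (hh : IsSubgraphTest f h M R) (hf : LipschitzWith K f) :
    ∫ y in {y : Plane | y 1 < f (y 0)}, fderiv ℝ h y (EuclideanSpace.single 0 1)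
      = -∫ x, deriv f x * h (graphCurve f x) := by
  have h0 := hh.integrableOn_fderiv_shear hf.continuous (EuclideanSpace.single 0 1)
  have h1 := hh.integrableOn_fderiv_shear hf.continuous (EuclideanSpace.single 1 1)
  have h1' : Integrable (fun p : ℝ × ℝ => deriv f p.1 *
      fderiv ℝ h (shear f p) (EuclideanSpace.single 1 1))
      (volume.prod (volume.restrict (Iio 0))) := by
    refine h1.bdd_mul (c := K) ?_ (Eventually.of_forall fun p => abs_deriv_le hf p.1)
    exact ((measurable_deriv f).comp measurable_fst).aestronglyMeasurable
  have hsum : ∫ p, (fderiv ℝ h (shear f p) (EuclideanSpace.single 0 1) + deriv f p.1 *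
      fderiv ℝ h (shear f p) (EuclideanSpace.single 1 1))
      ∂(volume.prod (volume.restrict (Iio (0 : ℝ)))) = 0 := by
    refine (integral_prod_symm _ (h0.add h1')).trans ?_
    refine setIntegral_eq_zero_of_forall_eq_zero fun z hz => ?_
    exact hh.integral_fderiv_tangential hf hz
  have h2 : ∫ p, deriv f p.1 * fderiv ℝ h (shear f p) (EuclideanSpace.single 1 1)
      ∂(volume.prod (volume.restrict (Iio (0 : ℝ)))) = ∫ x, deriv f x * h (graphCurve f x) := by
    rw [integral_prod _ h1']
    refine integral_congr_ae (Eventually.of_forall fun x => ?_)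
    simp only
    rw [integral_const_mul, hh.setIntegral_fderiv_vertical hf.continuous]
  rw [integral_add h0 h1', h2] at hsum
  rw [hh.setIntegral_fderiv_eq hf.continuous, ← integral_prod _ h0]
  linarith

theorem integrable_graphCurve (hh : IsSubgraphTest f h M R) (hf : LipschitzWith K f) :
    Integrable fun x => h (graphCurve f x) := by
  have h1 := hh.integrableOn_fderiv_shear hf.continuous (EuclideanSpace.single 1 1)
  refine h1.integral_prod_left.congr (Eventually.of_forall fun x => ?_)
  exact hh.setIntegral_fderiv_vertical hf.continuous x

theorem integrable_normal (hh : IsSubgraphTest f h M R) (hf : LipschitzWith K f) (v : Plane) :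
    Integrable fun x => h (graphCurve f x) * (v 1 - deriv f x * v 0) := by
  have h1 := hh.integrable_graphCurve hf
  have h2 : Integrable fun x => deriv f x * h (graphCurve f x) :=
    h1.bdd_mul (c := K) (measurable_deriv f).aestronglyMeasurable
      (Eventually.of_forall fun x => abs_deriv_le hf x)
  refine ((h1.mul_const (v 1)).sub (h2.mul_const (v 0))).congr (Eventually.of_forall fun x => ?_)
  simp only [Pi.sub_apply]
  ring

/-- The divergence theorem on the region below the graph of a Lipschitz function. -/
theorem setIntegral_fderiv (hh : IsSubgraphTest f h M R) (hf : LipschitzWith K f) (v : Plane) :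
    ∫ y in {y : Plane | y 1 < f (y 0)}, fderiv ℝ h y v
      = ∫ x, h (graphCurve f x) * (v 1 - deriv f x * v 0) := by
  have hv : v = v 0 • EuclideanSpace.single 0 1 + v 1 • EuclideanSpace.single 1 1 := by
    ext i; fin_cases i <;> simp
  have h1 := hh.integrable_graphCurve hf
  have h2 : Integrable fun x => deriv f x * h (graphCurve f x) :=
    h1.bdd_mul (c := K) (measurable_deriv f).aestronglyMeasurable
      (Eventually.of_forall fun x => abs_deriv_le hf x)
  have h3 : ∀ y, fderiv ℝ h y v = v 0 * fderiv ℝ h y (EuclideanSpace.single 0 1)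
      + v 1 * fderiv ℝ h y (EuclideanSpace.single 1 1) := fun y => by
    conv_lhs => rw [hv]
    rw [map_add, map_smul, map_smul, smul_eq_mul, smul_eq_mul]
  simp_rw [h3]
  rw [integral_add ((hh.integrableOn_fderiv hf.continuous _).const_mul _)
    ((hh.integrableOn_fderiv hf.continuous _).const_mul _), integral_const_mul, integral_const_mul,
    hh.setIntegral_fderiv_horizontal hf, hh.setIntegral_fderiv_eq hf.continuous]
  simp_rw [hh.setIntegral_fderiv_vertical hf.continuous]
  rw [← integral_const_mul, mul_neg, ← integral_const_mul, neg_add_eq_sub,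
    ← integral_sub (h1.const_mul _) (h2.const_mul _)]
  congr 1
  ext x
  ring

end IsSubgraphTest

end Subgraph

/-! ### From charts to the whole domain by a partition of unity -/

section GaussGreen

variable {Ω : Set Plane} {e : Plane ≃ₗᵢ[ℝ] Plane} {K : ℝ≥0} {f : ℝ → ℝ} {U : Set Plane}
  {k : Plane → ℝ}

theorem IsBoundedLipschitzDomain.isCompact_closure (hΩ : IsBoundedLipschitzDomain Ω) :
    IsCompact (closure Ω) :=
  hΩ.isBounded.isCompact_closure

theorem fderivWithin_closure_eq_fderiv (hΩ : IsOpen Ω) (k : Plane → ℝ) {y : Plane} (hy : y ∈ Ω) :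
    fderivWithin ℝ k (closure Ω) y = fderiv ℝ k y :=
  fderivWithin_of_mem_nhds (mem_of_superset (hΩ.mem_nhds hy) subset_closure)

theorem IsBoundedLipschitzDomain.exists_norm_fderiv_le (hΩ : IsBoundedLipschitzDomain Ω)
    (hk : ContDiffOn ℝ 1 k (closure Ω)) : ∃ M, 0 ≤ M ∧ ∀ y ∈ Ω, ‖fderiv ℝ k y‖ ≤ M := by
  obtain ⟨M, hM⟩ := hΩ.isCompact_closure.exists_bound_of_continuousOn
    (hk.continuousOn_fderivWithin hΩ.uniqueDiffOn_closure le_rfl)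
  refine ⟨|M|, abs_nonneg M, fun y hy => ?_⟩
  rw [← fderivWithin_closure_eq_fderiv hΩ.isOpen k hy]
  exact (hM y (subset_closure hy)).trans (le_abs_self M)

theorem contDiffAt_of_mem (hΩ : IsOpen Ω) (hk : ContDiffOn ℝ 1 k (closure Ω)) {y : Plane}
    (hy : y ∈ Ω) : ContDiffAt ℝ 1 k y :=
  hk.contDiffAt (mem_of_superset (hΩ.mem_nhds hy) subset_closure)

/-- Inside `U` the domain and the subgraph coincide. Outside `U` the function vanishes near every
point, so regularity on `closure Ω` transfers to the entire subgraph. -/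
theorem IsGraphChart.isSubgraphTest (h : IsGraphChart Ω e K f U) (hΩ : IsBoundedLipschitzDomain Ω)
    (hk : ContDiffOn ℝ 1 k (closure Ω)) (hkU : tsupport k ⊆ U) (hU : Bornology.IsBounded U) :
    ∃ M R, IsSubgraphTest f (k ∘ e.symm) M R := by
  obtain ⟨M, hM0, hM⟩ := hΩ.exists_norm_fderiv_le hk
  obtain ⟨R, hR⟩ := hU.exists_norm_le
  have hsymm := e.symm.continuous
  have hoff : ∀ y, e.symm y ∉ U → k ∘ e.symm =ᶠ[𝓝 y] fun _ => 0 := fun y hy => by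
    have : k =ᶠ[𝓝 (e.symm y)] 0 := notMem_tsupport_iff_eventuallyEq.1 fun hmem => hy (hkU hmem)
    exact hsymm.continuousAt.eventually this
  have hmem : ∀ y : Plane, e.symm y ∈ U → (e.symm y ∈ Ω ↔ y 1 < f (y 0)) := fun y hy => by
    rw [h.mem_iff _ hy, e.apply_symm_apply]
  have hmemc : ∀ y : Plane, e.symm y ∈ U → (e.symm y ∈ closure Ω ↔ y 1 ≤ f (y 0)) := fun y hy => by
    rw [h.mem_closure_iff hy, e.apply_symm_apply]
  refine ⟨M, R, ?_, ?_, ?_, ?_⟩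
  · intro y hy
    by_cases hyU : e.symm y ∈ U
    · have h1 := hk.continuousOn _ ((hmemc y hyU).2 hy)
      refine ContinuousWithinAt.comp_of_mem_nhdsWithin_image (t := closure Ω) h1
        hsymm.continuousWithinAt ?_
      have hU' : U ∈ 𝓝[e.symm '' {y : Plane | y 1 ≤ f (y 0)}] (e.symm y) :=
        mem_nhdsWithin_of_mem_nhds (h.isOpen.mem_nhds hyU)
      filter_upwards [hU', self_mem_nhdsWithin] with z hz hz'
      obtain ⟨x, hx, rfl⟩ := hz'
      exact (hmemc x hz).2 hx
    · exact (continuousAt_const.congr (hoff y hyU).symm).continuousWithinAt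
  · intro y hy
    refine ContDiffAt.contDiffWithinAt ?_
    by_cases hyU : e.symm y ∈ U
    · exact (contDiffAt_of_mem hΩ.isOpen hk ((hmem y hyU).2 hy)).comp y
        e.symm.contDiff.contDiffAt
    · exact contDiffAt_const.congr_of_eventuallyEq (hoff y hyU)
  · intro y hy
    by_cases hyU : e.symm y ∈ U
    · have h1 := e.symm.toContinuousLinearEquiv.comp_right_fderiv (f := k) (x := y)
      have h2 : fderiv ℝ (k ∘ e.symm) y
        = (fderiv ℝ k (e.symm y)).comp (e.symm.toContinuousLinearEquiv : Plane →L[ℝ] Plane) := h1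
      rw [h2]
      refine (ContinuousLinearMap.opNorm_comp_le _ _).trans ?_
      have h3 : ‖(e.symm.toContinuousLinearEquiv : Plane →L[ℝ] Plane)‖ ≤ 1 :=
        ContinuousLinearMap.opNorm_le_bound _ zero_le_one fun v => by simp
      exact (mul_le_of_le_one_right (norm_nonneg _) h3).trans (hM _ ((hmem y hyU).2 hy))
    · rw [(hoff y hyU).fderiv_eq, fderiv_fun_const]
      simpa using hM0
  · intro y hy
    by_contra hne
    have : e.symm y ∈ U := hkU (subset_tsupport k hne)
    have := hR _ this
    rw [e.symm.norm_map] at this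
    linarith

theorem IsGraphChart.indicator_fderiv (h : IsGraphChart Ω e K f U) (hkU : tsupport k ⊆ U)
    (w y : Plane) : Ω.indicator (fun y => fderiv ℝ k y w) (e.symm y) =
      {y : Plane | y 1 < f (y 0)}.indicator (fun y => fderiv ℝ (k ∘ e.symm) y (e w)) y := by
  have h1 : fderiv ℝ (k ∘ e.symm) y
        = (fderiv ℝ k (e.symm y)).comp (e.symm.toContinuousLinearEquiv : Plane →L[ℝ] Plane) :=
    e.symm.toContinuousLinearEquiv.comp_right_fderiv (f := k) (x := y)
  have h2 : fderiv ℝ (k ∘ e.symm) y (e w) = fderiv ℝ k (e.symm y) w := by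
    rw [h1]; simp
  by_cases hyU : e.symm y ∈ U
  · have hiff : e.symm y ∈ Ω ↔ y 1 < f (y 0) := by rw [h.mem_iff _ hyU, e.apply_symm_apply]
    by_cases hy : e.symm y ∈ Ω
    · rw [indicator_of_mem hy, indicator_of_mem (s := {y : Plane | y 1 < f (y 0)}) (hiff.1 hy), h2]
    · rw [indicator_of_notMem hy, indicator_of_notMem (s := {y : Plane | y 1 < f (y 0)})
        fun h' => hy (hiff.2 h')]
  · have h0 : fderiv ℝ k (e.symm y) w = 0 := by
      have : k =ᶠ[𝓝 (e.symm y)] 0 := notMem_tsupport_iff_eventuallyEq.1 fun hmem => hyU (hkU hmem)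
      rw [this.fderiv_eq]; simp
    classical rw [indicator_apply, indicator_apply, h2, h0]
    simp

/-- The divergence theorem for a function supported in a chart. -/
theorem IsGraphChart.gaussGreen (h : IsGraphChart Ω e K f U) (hΩ : IsBoundedLipschitzDomain Ω)
    (hk : ContDiffOn ℝ 1 k (closure Ω)) (hkU : tsupport k ⊆ U) (hU : Bornology.IsBounded U)
    (w : Plane) :
    IntegrableOn (fun y => fderiv ℝ k y w) Ω ∧
    Integrable (fun y => k y * inner ℝ w (outwardNormal Ω y)) (arcLength Ω) ∧
    ∫ y in Ω, fderiv ℝ k y w = ∫ y, k y * inner ℝ w (outwardNormal Ω y) ∂arcLength Ω := by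
  obtain ⟨M, R, hT⟩ := h.isSubgraphTest hΩ hk hkU hU
  have hSm := (isOpen_subgraph h.lipschitz.continuous).measurableSet
  have hΩm := hΩ.isOpen.measurableSet
  have hmp : MeasurePreserving e.symm := e.symm.measurePreserving
  have hme : MeasurableEmbedding e.symm := e.symm.toHomeomorph.measurableEmbedding
  have hind := h.indicator_fderiv hkU w
  have hG0 : ∀ y ∉ U, k y * inner ℝ w (outwardNormal Ω y) = 0 := fun y hy => by
    rw [image_eq_zero_of_notMem_tsupport fun hmem => hy (hkU hmem), zero_mul]
  -- The arc length factor √(1 + f'²) cancels the normalization of the normal.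
  have hae : (fun x => √(1 + deriv f x ^ 2) * (k (e.symm (graphCurve f x)) *
      inner ℝ w (outwardNormal Ω (e.symm (graphCurve f x))))) =ᵐ[volume]
      fun x => (k ∘ e.symm) (graphCurve f x) * ((e w) 1 - deriv f x * (e w) 0) := by
    filter_upwards [h.lipschitz.ae_differentiableAt_real] with x hx
    by_cases hxU : e.symm (graphCurve f x) ∈ U
    · have h1 := (h.isOutwardUnitNormal hxU (by simp [graphCurve])
        (by simpa [graphCurve] using hx)).outwardNormal_eq
      have h2 : (e (e.symm (graphCurve f x))) 0 = x := by simp [graphCurve]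
      have h3 := (sqrt_one_add_sq_pos (deriv f x)).ne'
      rw [h1, h2, ← e.inner_map_map, e.apply_symm_apply, inner_plane]
      simp only [graphNormal, PiLp.smul_apply, smul_eq_mul, Function.comp_apply]
      simp only [Matrix.cons_val_zero, Matrix.cons_val_one]
      field_simp
      ring
    · have : k (e.symm (graphCurve f x)) = 0 :=
        image_eq_zero_of_notMem_tsupport fun hmem => hxU (hkU hmem)
      simp [this]
  refine ⟨?_, ?_, ?_⟩
  · rw [← integrable_indicator_iff hΩm, ← hmp.integrable_comp_emb hme]
    refine Integrable.congr ?_ (Eventually.of_forall fun y => (hind y).symm)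
    exact (integrable_indicator_iff hSm).2 (hT.integrableOn_fderiv h.lipschitz.continuous _)
  · rw [h.integrable_arcLength_iff hΩ.isOpen hG0]
    exact (hT.integrable_normal h.lipschitz (e w)).congr hae.symm
  · rw [h.integral_arcLength hΩ.isOpen hG0, integral_congr_ae hae,
      ← hT.setIntegral_fderiv h.lipschitz, ← integral_indicator hSm, ← integral_indicator hΩm,
      ← hmp.integral_comp hme]
    exact integral_congr_ae (Eventually.of_forall hind)

theorem IsGraphChart.mono (h : IsGraphChart Ω e K f U) {V : Set Plane} (hV : IsOpen V)
    (hVU : V ⊆ U) : IsGraphChart Ω e K f V :=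
  ⟨h.lipschitz, hV, fun y hy => h.mem_iff y (hVU hy)⟩

/-- The divergence theorem on a bounded Lipschitz domain, for the vector field `k w` with `w` a
constant vector. -/
theorem IsBoundedLipschitzDomain.gaussGreen (hΩ : IsBoundedLipschitzDomain Ω)
    (hk : ContDiffOn ℝ 1 k (closure Ω)) (w : Plane) :
    IntegrableOn (fun y => fderiv ℝ k y w) Ω ∧
    Integrable (fun y => k y * inner ℝ w (outwardNormal Ω y)) (arcLength Ω) ∧
    ∫ y in Ω, fderiv ℝ k y w = ∫ y, k y * inner ℝ w (outwardNormal Ω y) ∂arcLength Ω := by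
  choose e K f U h hU using fun p : closure Ω => hΩ.exists_isGraphChart p.2
  -- Intersecting with unit balls makes the charts bounded, as the local theorem requires.
  set V : closure Ω → Set Plane := fun p => U p ∩ Metric.ball (p : Plane) 1 with hV
  have hVo : ∀ p, IsOpen (V p) := fun p => (h p).isOpen.inter Metric.isOpen_ball
  have hVb : ∀ p, Bornology.IsBounded (V p) := fun p => Metric.isBounded_ball.subset inter_subset_right
  obtain ⟨χ, hχ⟩ := SmoothPartitionOfUnity.exists_isSubordinate (modelWithCornersSelf ℝ Plane)
    (s := closure Ω) isClosed_closure V hVo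
    (fun p hp => mem_iUnion.2 ⟨⟨p, hp⟩, hU _, Metric.mem_ball_self one_pos⟩)
  have hfin := χ.locallyFinite.finite_nonempty_inter_compact hΩ.isCompact_closure
  set F := hfin.toFinset with hF
  -- Only finitely many cutoffs meet the compact closure. They need to sum to 1 only there, since
  -- both sides of the theorem see only `Ω` and its frontier.
  have hsum : ∀ y ∈ closure Ω, ∑ i ∈ F, χ i y * k y = k y := by
    intro y hy
    rw [← Finset.sum_mul, ← finsum_eq_sum_of_support_subset _ (s := F), χ.sum_eq_one hy, one_mul]
    intro i hi
    rw [hF, Finite.coe_toFinset]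
    exact ⟨y, hi, hy⟩
  have hsmooth : ∀ i, ContDiff ℝ ∞ (χ i) := fun i => (χ i).contMDiff.contDiff
  have hck : ∀ i, ContDiffOn ℝ 1 (fun y => χ i y * k y) (closure Ω) := fun i =>
    ((hsmooth i).of_le (by exact_mod_cast le_top)).contDiffOn.mul hk
  have hloc := fun i => ((h i).mono (hVo i) inter_subset_left).gaussGreen hΩ (hck i)
    ((closure_mono (Function.support_mul_subset_left _ _)).trans (hχ i)) (hVb i) w
  have hder : ∀ y ∈ Ω, fderiv ℝ k y w = ∑ i ∈ F, fderiv ℝ (fun y => χ i y * k y) y w := by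
    intro y hy
    have h1 : k =ᶠ[𝓝 y] fun z => ∑ i ∈ F, χ i z * k z := by
      filter_upwards [hΩ.isOpen.mem_nhds hy] with z hz using (hsum z (subset_closure hz)).symm
    rw [h1.fderiv_eq, fderiv_fun_sum fun i _ =>
      (contDiffAt_of_mem hΩ.isOpen (hck i) hy).differentiableAt one_ne_zero]
    simp
  have hbd : ∀ᵐ y ∂arcLength Ω, k y * inner ℝ w (outwardNormal Ω y)
      = ∑ i ∈ F, χ i y * k y * inner ℝ w (outwardNormal Ω y) := by
    rw [arcLength, ae_restrict_iff' isClosed_frontier.measurableSet]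
    refine Eventually.of_forall fun y hy => ?_
    rw [← Finset.sum_mul, hsum y (frontier_subset_closure hy)]
  refine ⟨?_, ?_, ?_⟩
  · refine IntegrableOn.congr_fun (f := fun y => ∑ i ∈ F, fderiv ℝ (fun y => χ i y * k y) y w) ?_
      (fun y hy => (hder y hy).symm) hΩ.isOpen.measurableSet
    exact integrable_finsetSum _ fun i _ => (hloc i).1
  · refine Integrable.congr ?_ (EventuallyEq.symm hbd)
    exact integrable_finsetSum _ fun i _ => (hloc i).2.1
  · rw [setIntegral_congr_fun hΩ.isOpen.measurableSet hder, integral_congr_ae hbd,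
      integral_finsetSum _ fun i _ => (hloc i).1, integral_finsetSum _ fun i _ => (hloc i).2.1]
    exact Finset.sum_congr rfl fun i _ => (hloc i).2.2

end GaussGreen

/-! ### Calculus on the closed space-time cylinder -/

section Calculus

variable {Ω : Set Plane} {T : ℝ}

/-- `a` is smooth on `closure Ω × [0, T]`. -/
def IsSmooth (Ω : Set Plane) (T : ℝ) (a : Plane → ℝ → ℝ) : Prop :=
  ContDiffOn ℝ ∞ (fun p : Plane × ℝ => a p.1 p.2) (closure Ω ×ˢ Icc 0 T)

theorem IsBoundedLipschitzDomain.uniqueDiffOn_cylinder (hΩ : IsBoundedLipschitzDomain Ω)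
    (hT : 0 < T) : UniqueDiffOn ℝ (closure Ω ×ˢ Icc 0 T) :=
  hΩ.uniqueDiffOn_closure.prod (uniqueDiffOn_Icc hT)

namespace IsSmooth

variable {a b : Plane → ℝ → ℝ}

theorem mul (ha : IsSmooth Ω T a) (hb : IsSmooth Ω T b) : IsSmooth Ω T fun x t => a x t * b x t :=
  ContDiffOn.mul ha hb

theorem continuousOn (ha : IsSmooth Ω T a) :
    ContinuousOn (fun p : Plane × ℝ => a p.1 p.2) (closure Ω ×ˢ Icc 0 T) :=
  ContDiffOn.continuousOn ha

theorem contDiffOn_slice (ha : IsSmooth Ω T a) {t : ℝ} (ht : t ∈ Icc 0 T) :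
    ContDiffOn ℝ 1 (fun y => a y t) (closure Ω) := by
  have h1 : ContDiffOn ℝ 1 (fun p : Plane × ℝ => a p.1 p.2) (closure Ω ×ˢ Icc 0 T) :=
    ContDiffOn.of_le ha (by exact_mod_cast le_top)
  exact h1.comp (f := fun y : Plane => (y, t)) (by fun_prop) fun y hy => ⟨hy, ht⟩

theorem continuousOn_time (ha : IsSmooth Ω T a) {x : Plane} (hx : x ∈ closure Ω) :
    ContinuousOn (a x) (Icc 0 T) :=
  ha.continuousOn.comp (f := fun t : ℝ => (x, t)) (by fun_prop) fun t ht => ⟨hx, ht⟩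

theorem hasFDerivWithinAt (ha : IsSmooth Ω T a) {p : Plane × ℝ}
    (hp : p ∈ closure Ω ×ˢ Icc 0 T) : HasFDerivWithinAt (fun p : Plane × ℝ => a p.1 p.2)
      (fderivWithin ℝ (fun p : Plane × ℝ => a p.1 p.2) (closure Ω ×ˢ Icc 0 T) p)
      (closure Ω ×ˢ Icc 0 T) p :=
  ((ContDiffOn.differentiableOn ha (by simp)) p hp).hasFDerivWithinAt

theorem fderivWithin_apply (ha : IsSmooth Ω T a) (hΩ : IsBoundedLipschitzDomain Ω) (hT : 0 < T)
    (v : Plane × ℝ) : ContDiffOn ℝ ∞ (fun p => fderivWithin ℝ (fun p : Plane × ℝ => a p.1 p.2)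
      (closure Ω ×ˢ Icc 0 T) p v) (closure Ω ×ˢ Icc 0 T) :=
  (ContDiffOn.fderivWithin ha (hΩ.uniqueDiffOn_cylinder hT) (by simp)).clm_apply contDiffOn_const

/-- At fixed time the partial derivative is the space-time derivative within the cylinder in the
direction (eⱼ, 0), by uniqueness of derivatives on `closure Ω`. Joint smoothness up to the boundary
follows. -/
theorem pderiv (ha : IsSmooth Ω T a) (hΩ : IsBoundedLipschitzDomain Ω) (hT : 0 < T) (j : Fin 2) :
    IsSmooth Ω T fun x t => pderiv Ω j (fun y => a y t) x := by
  refine (ha.fderivWithin_apply hΩ hT (EuclideanSpace.single j 1, 0)).congr ?_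
  rintro ⟨x, t⟩ hp
  have h1 : HasFDerivWithinAt (fun y : Plane => (y, t))
      (ContinuousLinearMap.inl ℝ Plane ℝ) (closure Ω) x :=
    (hasFDerivAt_prodMk_left x t).hasFDerivWithinAt
  have h2 := (ha.hasFDerivWithinAt hp).comp x h1
    (show MapsTo _ (closure Ω) (closure Ω ×ˢ Icc 0 T) from fun y hy => ⟨hy, hp.2⟩)
  have h3 := h2.fderivWithin (hΩ.uniqueDiffOn_closure x hp.1)
  change fderivWithin ℝ (fun y => a y t) (closure Ω) x _ = _
  rw [show (fun y => a y t) = (fun p : Plane × ℝ => a p.1 p.2) ∘ fun y => (y, t) from rfl, h3]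
  simp

theorem hasDerivWithinAt_fderivWithin (ha : IsSmooth Ω T a) {x : Plane} {t : ℝ}
    (hx : x ∈ closure Ω) (ht : t ∈ Icc 0 T) :
    HasDerivWithinAt (a x) (fderivWithin ℝ (fun p : Plane × ℝ => a p.1 p.2)
      (closure Ω ×ˢ Icc 0 T) (x, t) (0, 1)) (Icc 0 T) t := by
  have h1 : HasDerivWithinAt (fun s : ℝ => (x, s)) ((0 : Plane), (1 : ℝ)) (Icc 0 T) t :=
    ((hasDerivAt_const t x).prodMk (hasDerivAt_id' t)).hasDerivWithinAt
  exact (ha.hasFDerivWithinAt (p := (x, t)) ⟨hx, ht⟩).comp_hasDerivWithinAt t h1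
    fun s hs => ⟨hx, hs⟩

theorem hasDerivWithinAt (ha : IsSmooth Ω T a) {x : Plane} {t : ℝ}
    (hx : x ∈ closure Ω) (ht : t ∈ Icc 0 T) :
    HasDerivWithinAt (a x) (derivWithin (a x) (Icc 0 T) t) (Icc 0 T) t :=
  (ha.hasDerivWithinAt_fderivWithin hx ht).differentiableWithinAt.hasDerivWithinAt

theorem tderiv (ha : IsSmooth Ω T a) (hΩ : IsBoundedLipschitzDomain Ω) (hT : 0 < T) :
    IsSmooth Ω T fun x t => derivWithin (a x) (Icc 0 T) t := by
  refine (ha.fderivWithin_apply hΩ hT (0, 1)).congr ?_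
  rintro ⟨x, t⟩ hp
  exact (ha.hasDerivWithinAt_fderivWithin hp.1 hp.2).derivWithin (uniqueDiffOn_Icc hT t hp.2)

end IsSmooth

theorem IsBoundedLipschitzDomain.integrableOn_of_continuousOn (hΩ : IsBoundedLipschitzDomain Ω)
    {F : Plane → ℝ} (hF : ContinuousOn F (closure Ω)) : IntegrableOn F Ω :=
  (hF.integrableOn_compact hΩ.isCompact_closure).mono_set subset_closure

/-- Differentiation under the integral sign, one-sidedly at the end points. -/
theorem IsBoundedLipschitzDomain.hasDerivWithinAt_setIntegral (hΩ : IsBoundedLipschitzDomain Ω)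
    {b b' : Plane → ℝ → ℝ}
    (hb : ContinuousOn (fun p : Plane × ℝ => b p.1 p.2) (closure Ω ×ˢ Icc 0 T))
    (hb' : ContinuousOn (fun p : Plane × ℝ => b' p.1 p.2) (closure Ω ×ˢ Icc 0 T))
    (hd : ∀ x ∈ closure Ω, ∀ t ∈ Icc 0 T, HasDerivWithinAt (b x) (b' x t) (Icc 0 T) t)
    {t : ℝ} (ht : t ∈ Icc 0 T) :
    HasDerivWithinAt (fun s => ∫ x in Ω, b x s) (∫ x in Ω, b' x t) (Icc 0 T) t := by
  obtain ⟨M, hM⟩ := (hΩ.isCompact_closure.prod isCompact_Icc).exists_bound_of_continuousOn hb'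
  have hslice : ∀ s ∈ Icc 0 T, IntegrableOn (fun x => b x s) Ω := fun s hs =>
    hΩ.integrableOn_of_continuousOn
      (hb.comp (f := fun x : Plane => (x, s)) (by fun_prop) fun x hx => ⟨hx, hs⟩)
  have hfin : IsFiniteMeasure (volume.restrict Ω) :=
    ⟨by rw [Measure.restrict_apply_univ]; exact hΩ.isBounded.measure_lt_top⟩
  rw [hasDerivWithinAt_iff_tendsto_slope]
  have hint : ∀ s ∈ Icc 0 T, slope (fun s => ∫ x in Ω, b x s) t s
      = ∫ x in Ω, slope (b x) t s := fun s hs => by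
    simp only [slope_def_module]
    rw [integral_smul, integral_sub (hslice s hs) (hslice t ht)]
  have hev : ∀ᶠ s in 𝓝[Icc 0 T \ {t}] t, s ∈ Icc 0 T \ {t} := self_mem_nhdsWithin
  refine Tendsto.congr' (f₁ := fun s => ∫ x in Ω, slope (b x) t s) ?_ ?_
  · filter_upwards [hev] with s hs using (hint s hs.1).symm
  refine tendsto_integral_filter_of_dominated_convergence (fun _ => M) ?_ ?_
    (integrable_const M) ?_
  · filter_upwards [hev] with s hs
    simp only [slope_def_module]
    exact (((hslice s hs.1).sub (hslice t ht)).smul (s - t)⁻¹).aestronglyMeasurable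
  · filter_upwards [hev] with s hs
    refine (ae_restrict_iff' hΩ.isOpen.measurableSet).2 (Eventually.of_forall fun x hx => ?_)
    have hpos : 0 < ‖s - t‖ := norm_pos_iff.2 (sub_ne_zero.2 hs.2)
    -- The mean value inequality bounds every difference quotient by `M`, the dominating constant on
    -- the bounded domain.
    have h1 := (convex_Icc 0 T).norm_image_sub_le_of_norm_hasDerivWithin_le
      (fun r hr => hd x (subset_closure hx) r hr) (fun r hr => hM (x, r) ⟨subset_closure hx, hr⟩)
      ht hs.1
    rw [slope_def_module, norm_smul, norm_inv, inv_mul_le_iff₀ hpos, mul_comm]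
    exact h1
  · refine (ae_restrict_iff' hΩ.isOpen.measurableSet).2 (Eventually.of_forall fun x hx => ?_)
    exact hasDerivWithinAt_iff_tendsto_slope.1 (hd x (subset_closure hx) t ht)

section PartialDerivatives

variable {F G : Plane → ℝ} {x : Plane}

theorem pderiv_mul (hΩ : IsBoundedLipschitzDomain Ω) (hF : ContDiffOn ℝ 1 F (closure Ω))
    (hG : ContDiffOn ℝ 1 G (closure Ω)) (hx : x ∈ closure Ω) (j : Fin 2) :
    pderiv Ω j (fun y => F y * G y) x = pderiv Ω j F x * G x + F x * pderiv Ω j G x := by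
  unfold pderiv
  rw [fderivWithin_fun_mul (hΩ.uniqueDiffOn_closure x hx)
    (hF.differentiableOn one_ne_zero x hx) (hG.differentiableOn one_ne_zero x hx)]
  simp
  ring

theorem pderiv_add (hΩ : IsBoundedLipschitzDomain Ω) (hF : ContDiffOn ℝ 1 F (closure Ω))
    (hG : ContDiffOn ℝ 1 G (closure Ω)) (hx : x ∈ closure Ω) (j : Fin 2) :
    pderiv Ω j (fun y => F y + G y) x = pderiv Ω j F x + pderiv Ω j G x := by
  unfold pderiv
  rw [fderivWithin_fun_add (hΩ.uniqueDiffOn_closure x hx)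
    (hF.differentiableOn one_ne_zero x hx) (hG.differentiableOn one_ne_zero x hx)]
  simp

theorem pderiv_sub (hΩ : IsBoundedLipschitzDomain Ω) (hF : ContDiffOn ℝ 1 F (closure Ω))
    (hG : ContDiffOn ℝ 1 G (closure Ω)) (hx : x ∈ closure Ω) (j : Fin 2) :
    pderiv Ω j (fun y => F y - G y) x = pderiv Ω j F x - pderiv Ω j G x := by
  unfold pderiv
  rw [fderivWithin_fun_sub (hΩ.uniqueDiffOn_closure x hx)
    (hF.differentiableOn one_ne_zero x hx) (hG.differentiableOn one_ne_zero x hx)]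
  simp

/-- The divergence theorem on a bounded Lipschitz domain. -/
theorem IsBoundedLipschitzDomain.divergence_theorem (hΩ : IsBoundedLipschitzDomain Ω)
    {W : Fin 2 → Plane → ℝ} (hW : ∀ j, ContDiffOn ℝ 1 (W j) (closure Ω)) :
    IntegrableOn (fun x => ∑ j, pderiv Ω j (W j) x) Ω ∧
    Integrable (fun x => ∑ j, W j x * outwardNormal Ω x j) (arcLength Ω) ∧
    ∫ x in Ω, ∑ j, pderiv Ω j (W j) x
      = ∫ x, ∑ j, W j x * outwardNormal Ω x j ∂arcLength Ω := by
  have h := fun j => hΩ.gaussGreen (hW j) (EuclideanSpace.single j 1)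
  have hn : ∀ j x, inner ℝ (EuclideanSpace.single j (1 : ℝ)) (outwardNormal Ω x)
      = outwardNormal Ω x j := fun j x => by simp [EuclideanSpace.inner_single_left]
  simp only [hn] at h
  have hp : ∀ j, ∀ x ∈ Ω, fderiv ℝ (W j) x (EuclideanSpace.single j 1) = pderiv Ω j (W j) x :=
    fun j x hx => by rw [pderiv, fderivWithin_closure_eq_fderiv hΩ.isOpen _ hx]
  have hi : ∀ j, IntegrableOn (fun x => pderiv Ω j (W j) x) Ω := fun j =>
    (h j).1.congr_fun (hp j) hΩ.isOpen.measurableSet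
  refine ⟨integrable_finsetSum _ fun j _ => hi j, integrable_finsetSum _ fun j _ => (h j).2.1, ?_⟩
  rw [integral_finsetSum _ fun j _ => hi j, integral_finsetSum _ fun j _ => (h j).2.1]
  refine Finset.sum_congr rfl fun j _ => ?_
  rw [← (h j).2.2]
  exact setIntegral_congr_fun hΩ.isOpen.measurableSet fun x hx => (hp j x hx).symm

end PartialDerivatives

end Calculus

/-! ### Local energy balance and its integration -/

section Energy

variable {Ω : Set Plane} {T ρ μ g : ℝ} {ζ : Plane → ℝ} {φ : Plane → ℝ → ℝ}
  {u : Plane → ℝ → Plane}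

theorem norm_sq_plane (v : Plane) : ‖v‖ ^ 2 = v 0 * v 0 + v 1 * v 1 := by
  rw [← coord_sq_add_sq, sq, sq]

namespace IsSmoothSolution

theorem isSmooth_height (h : IsSmoothSolution Ω T ρ μ g ζ φ u) : IsSmooth Ω T φ :=
  h.smooth_height

theorem isSmooth_velocity (h : IsSmoothSolution Ω T ρ μ g ζ φ u) (i : Fin 2) :
    IsSmooth Ω T fun x t => u x t i :=
  contDiffOn_euclidean.1 h.smooth_velocity i

theorem isSmooth_strain (h : IsSmoothSolution Ω T ρ μ g ζ φ u) (hΩ : IsBoundedLipschitzDomain Ω)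
    (hT : 0 < T) (i j : Fin 2) : IsSmooth Ω T fun x t => strain Ω (fun z => u z t) x i j :=
  (ContDiffOn.add ((h.isSmooth_velocity i).pderiv hΩ hT j)
    ((h.isSmooth_velocity j).pderiv hΩ hT i)).div_const 2

theorem contDiffOn_elevation (h : IsSmoothSolution Ω T ρ μ g ζ φ u)
    (hζ : ContDiffOn ℝ 1 ζ (closure Ω)) {t : ℝ} (ht : t ∈ Icc 0 T) :
    ContDiffOn ℝ 1 (fun y => elevation ζ φ y t) (closure Ω) :=
  (h.isSmooth_height.contDiffOn_slice ht).sub hζ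

theorem pderiv_elevation (h : IsSmoothSolution Ω T ρ μ g ζ φ u)
    (hΩ : IsBoundedLipschitzDomain Ω) (hζ : ContDiffOn ℝ 1 ζ (closure Ω)) {t : ℝ}
    (ht : t ∈ Icc 0 T) {x : Plane} (hx : x ∈ closure Ω) (j : Fin 2) :
    pderiv Ω j (fun y => elevation ζ φ y t) x = pderiv Ω j (fun y => φ y t) x - pderiv Ω j ζ x :=
  pderiv_sub hΩ (h.isSmooth_height.contDiffOn_slice ht) hζ hx j

/-- Density of the open interval carries the equations, assumed only for 0 < t < T, to the
endpoints. -/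
theorem eq_zero_of_eq_zero_on_Ioo (hT : 0 < T) {k : ℝ → ℝ} (hk : ContinuousOn k (Icc 0 T))
    (h0 : ∀ t ∈ Ioo 0 T, k t = 0) {t : ℝ} (ht : t ∈ Icc 0 T) : k t = 0 :=
  EqOn.of_subset_closure (f := k) (g := fun _ => 0) h0 hk continuousOn_const Ioo_subset_Icc_self
    (by rw [closure_Ioo hT.ne]) ht

theorem derivWithin_eq_deriv {k : ℝ → ℝ} {t : ℝ} (ht : t ∈ Ioo 0 T) :
    derivWithin k (Icc 0 T) t = deriv k t :=
  derivWithin_of_mem_nhds (Icc_mem_nhds ht.1 ht.2)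

/-- The equation of mass conservation holds up to the initial and final times. -/
theorem mass_Icc (h : IsSmoothSolution Ω T ρ μ g ζ φ u) (hΩ : IsBoundedLipschitzDomain Ω)
    (hT : 0 < T) {x : Plane} (hx : x ∈ Ω) {t : ℝ} (ht : t ∈ Icc 0 T) :
    derivWithin (φ x) (Icc 0 T) t + ∑ j, pderiv Ω j (fun y => φ y t * u y t j) x = 0 := by
  have hxc := subset_closure hx
  refine eq_zero_of_eq_zero_on_Ioo hT (k := fun t => derivWithin (φ x) (Icc 0 T) t
    + ∑ j, pderiv Ω j (fun y => φ y t * u y t j) x) ?_ (fun s hs => ?_) ht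
  · refine ((h.isSmooth_height.tderiv hΩ hT).continuousOn_time hxc).add ?_
    refine continuousOn_finsetSum _ fun j _ => ?_
    exact ((h.isSmooth_height.mul (h.isSmooth_velocity j)).pderiv hΩ hT j).continuousOn_time hxc
  · simp only
    rw [derivWithin_eq_deriv hs]
    exact h.mass x hx s hs

/-- The momentum equation holds up to the initial and final times. -/
theorem momentum_Icc (h : IsSmoothSolution Ω T ρ μ g ζ φ u) (hΩ : IsBoundedLipschitzDomain Ω)
    (hT : 0 < T) (hζ : ContDiffOn ℝ 1 ζ (closure Ω)) {x : Plane} (hx : x ∈ Ω) {t : ℝ}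
    (ht : t ∈ Icc 0 T) (i : Fin 2) :
    ρ * φ x t * (derivWithin (fun s => u x s i) (Icc 0 T) t
        + ∑ j, u x t j * pderiv Ω j (fun y => u y t i) x)
      - 2 * μ * ∑ j, pderiv Ω j (fun y => φ y t * strain Ω (fun z => u z t) y i j) x
      + ρ * g * φ x t * (pderiv Ω i (fun y => φ y t) x - pderiv Ω i ζ x) = 0 := by
  have hxc := subset_closure hx
  refine eq_zero_of_eq_zero_on_Ioo hT (k := fun t =>
    ρ * φ x t * (derivWithin (fun s => u x s i) (Icc 0 T) t
        + ∑ j, u x t j * pderiv Ω j (fun y => u y t i) x)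
      - 2 * μ * ∑ j, pderiv Ω j (fun y => φ y t * strain Ω (fun z => u z t) y i j) x
      + ρ * g * φ x t * (pderiv Ω i (fun y => φ y t) x - pderiv Ω i ζ x)) ?_ (fun s hs => ?_) ht
  · have hφ := h.isSmooth_height.continuousOn_time hxc
    have hu := fun j => (h.isSmooth_velocity j).continuousOn_time hxc
    have hut := ((h.isSmooth_velocity i).tderiv hΩ hT).continuousOn_time hxc
    have hux := fun j => ((h.isSmooth_velocity i).pderiv hΩ hT j).continuousOn_time hxc
    have hφx := (h.isSmooth_height.pderiv hΩ hT i).continuousOn_time hxc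
    have hS := fun j => ((h.isSmooth_height.mul (h.isSmooth_strain hΩ hT i j)).pderiv hΩ hT
      j).continuousOn_time hxc
    refine ContinuousOn.add (ContinuousOn.sub ?_ ?_) ?_
    · exact (continuousOn_const.mul hφ).mul
        (hut.add (continuousOn_finsetSum _ fun j _ => (hu j).mul (hux j)))
    · exact continuousOn_const.mul (continuousOn_finsetSum _ fun j _ => hS j)
    · exact (continuousOn_const.mul hφ).mul (hφx.sub continuousOn_const)
  · simp only
    rw [derivWithin_eq_deriv hs, ← h.pderiv_elevation hΩ hζ (Ioo_subset_Icc_self hs) hxc]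
    exact h.momentum x hx s hs i

end IsSmoothSolution

/-- The components of the vector field `φ |u|² u`. -/
def kineticField (φ : Plane → ℝ → ℝ) (u : Plane → ℝ → Plane) (t : ℝ) (j : Fin 2) (x : Plane) : ℝ :=
  φ x t * (u x t 0 * u x t 0 + u x t 1 * u x t 1) * u x t j

/-- The components of the vector field `φ η u`. -/
def potentialField (ζ : Plane → ℝ) (φ : Plane → ℝ → ℝ) (u : Plane → ℝ → Plane) (t : ℝ) (j : Fin 2)
    (x : Plane) : ℝ :=
  φ x t * elevation ζ φ x t * u x t j

/-- The components of the vector field `φ D(u) u`. -/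
noncomputable def viscousField (Ω : Set Plane) (φ : Plane → ℝ → ℝ) (u : Plane → ℝ → Plane) (t : ℝ)
    (j : Fin 2) (x : Plane) : ℝ :=
  φ x t * strain Ω (fun z => u z t) x 0 j * u x t 0
    + φ x t * strain Ω (fun z => u z t) x 1 j * u x t 1

/-- The time derivative of the energy density. -/
noncomputable def energyRate (T ρ g : ℝ) (ζ : Plane → ℝ) (φ : Plane → ℝ → ℝ)
    (u : Plane → ℝ → Plane) (x : Plane) (t : ℝ) : ℝ :=
  ρ / 2 * (derivWithin (φ x) (Icc 0 T) t * (u x t 0 * u x t 0 + u x t 1 * u x t 1)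
    + φ x t * (2 * u x t 0 * derivWithin (fun s => u x s 0) (Icc 0 T) t
      + 2 * u x t 1 * derivWithin (fun s => u x s 1) (Icc 0 T) t))
  + ρ * g * elevation ζ φ x t * derivWithin (φ x) (Icc 0 T) t

theorem kineticFlux_eq (Ω : Set Plane) (φ : Plane → ℝ → ℝ) (u : Plane → ℝ → Plane) (t : ℝ) :
    kineticFlux Ω φ u t = fun x => ∑ j, kineticField φ u t j x * outwardNormal Ω x j := by
  ext x
  rw [kineticFlux, norm_sq_plane, inner_plane, Fin.sum_univ_two, kineticField, kineticField]
  ring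

theorem potentialFlux_eq (Ω : Set Plane) (ζ : Plane → ℝ) (φ : Plane → ℝ → ℝ)
    (u : Plane → ℝ → Plane) (t : ℝ) :
    potentialFlux Ω ζ φ u t = fun x => ∑ j, potentialField ζ φ u t j x * outwardNormal Ω x j := by
  ext x
  rw [potentialFlux, inner_plane, Fin.sum_univ_two, potentialField, potentialField]
  ring

theorem viscousFlux_eq (Ω : Set Plane) (φ : Plane → ℝ → ℝ) (u : Plane → ℝ → Plane) (t : ℝ) :
    viscousFlux Ω φ u t = fun x => ∑ j, viscousField Ω φ u t j x * outwardNormal Ω x j := by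
  ext x
  simp only [viscousFlux, viscousField, Fin.sum_univ_two]
  ring

namespace IsSmoothSolution

variable {t : ℝ}

theorem contDiffOn_kineticField (h : IsSmoothSolution Ω T ρ μ g ζ φ u) (ht : t ∈ Icc 0 T)
    (j : Fin 2) : ContDiffOn ℝ 1 (kineticField φ u t j) (closure Ω) := by
  have hu := fun i => (h.isSmooth_velocity i).contDiffOn_slice ht
  exact ((h.isSmooth_height.contDiffOn_slice ht).mul
    (((hu 0).mul (hu 0)).add ((hu 1).mul (hu 1)))).mul (hu j)

theorem contDiffOn_potentialField (h : IsSmoothSolution Ω T ρ μ g ζ φ u)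
    (hζ : ContDiffOn ℝ 1 ζ (closure Ω)) (ht : t ∈ Icc 0 T) (j : Fin 2) :
    ContDiffOn ℝ 1 (potentialField ζ φ u t j) (closure Ω) :=
  ((h.isSmooth_height.contDiffOn_slice ht).mul (h.contDiffOn_elevation hζ ht)).mul
    ((h.isSmooth_velocity j).contDiffOn_slice ht)

theorem contDiffOn_viscousField (h : IsSmoothSolution Ω T ρ μ g ζ φ u)
    (hΩ : IsBoundedLipschitzDomain Ω) (hT : 0 < T) (ht : t ∈ Icc 0 T) (j : Fin 2) :
    ContDiffOn ℝ 1 (viscousField Ω φ u t j) (closure Ω) := by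
  have hφ := h.isSmooth_height.contDiffOn_slice ht
  have hu := fun i => (h.isSmooth_velocity i).contDiffOn_slice ht
  have hS := fun i => (h.isSmooth_strain hΩ hT i j).contDiffOn_slice ht
  exact ((hφ.mul (hS 0)).mul (hu 0)).add ((hφ.mul (hS 1)).mul (hu 1))

/-- The energy balance in local form. -/
theorem energyRate_eq (h : IsSmoothSolution Ω T ρ μ g ζ φ u) (hΩ : IsBoundedLipschitzDomain Ω)
    (hT : 0 < T) (hζ : ContDiffOn ℝ 1 ζ (closure Ω)) (ht : t ∈ Icc 0 T) {x : Plane} (hx : x ∈ Ω) :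
    energyRate T ρ g ζ φ u x t = -(ρ / 2) * (∑ j, pderiv Ω j (kineticField φ u t j) x)
      + -(ρ * g) * (∑ j, pderiv Ω j (potentialField ζ φ u t j) x)
      + 2 * μ * (∑ j, pderiv Ω j (viscousField Ω φ u t j) x)
      + -(2 * μ) * dissipationDensity Ω φ u t x := by
  have hxc := subset_closure hx
  have hφ := h.isSmooth_height.contDiffOn_slice ht
  have hη := h.contDiffOn_elevation hζ ht
  have hu := fun i => (h.isSmooth_velocity i).contDiffOn_slice ht
  have hS := fun i j => (h.isSmooth_strain hΩ hT i j).contDiffOn_slice ht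
  have hm := h.mass_Icc hΩ hT hx ht
  have h0 := h.momentum_Icc hΩ hT hζ hx ht 0
  have h1 := h.momentum_Icc hΩ hT hζ hx ht 1
  have hk : ∀ j, pderiv Ω j (kineticField φ u t j) x = _ := fun j => by
    unfold kineticField
    rw [pderiv_mul hΩ (hφ.mul (((hu 0).mul (hu 0)).add ((hu 1).mul (hu 1)))) (hu j) hxc,
      pderiv_mul hΩ hφ (((hu 0).mul (hu 0)).add ((hu 1).mul (hu 1))) hxc,
      pderiv_add hΩ ((hu 0).mul (hu 0)) ((hu 1).mul (hu 1)) hxc, pderiv_mul hΩ (hu 0) (hu 0) hxc,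
      pderiv_mul hΩ (hu 1) (hu 1) hxc]
  have hp : ∀ j, pderiv Ω j (potentialField ζ φ u t j) x = _ := fun j => by
    unfold potentialField
    rw [pderiv_mul hΩ (hφ.mul hη) (hu j) hxc, pderiv_mul hΩ hφ hη hxc,
      h.pderiv_elevation hΩ hζ ht hxc]
  have hv : ∀ j, pderiv Ω j (viscousField Ω φ u t j) x = _ := fun j => by
    unfold viscousField
    rw [pderiv_add hΩ ((hφ.mul (hS 0 j)).mul (hu 0)) ((hφ.mul (hS 1 j)).mul (hu 1)) hxc,
      pderiv_mul hΩ (hφ.mul (hS 0 j)) (hu 0) hxc, pderiv_mul hΩ (hφ.mul (hS 1 j)) (hu 1) hxc,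
      pderiv_mul hΩ hφ (hS 0 j) hxc, pderiv_mul hΩ hφ (hS 1 j) hxc]
  simp only [Fin.sum_univ_two, pderiv_mul hΩ hφ (hu _) hxc, pderiv_mul hΩ hφ (hS _ _) hxc]
    at hm h0 h1
  simp only [Fin.sum_univ_two, hk, hp, hv, energyRate, dissipationDensity]
  -- With the entries of D(u) at `x` expanded, the identity D(u) : ∇u = |D(u)|² becomes polynomial
  -- and is left to the final algebra.
  have hst : ∀ i j, strain Ω (fun z => u z t) x i j
    = (pderiv Ω j (fun y => u y t i) x + pderiv Ω i (fun y => u y t j) x) / 2 := fun _ _ => rfl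
  simp only [hst] at h0 h1 ⊢
  -- Momentum is tested against `u`. In the mass equation, (ρ/2)|u|² completes the transport of
  -- kinetic energy and ρgη that of potential energy.
  linear_combination u x t 0 * h0 + u x t 1 * h1
    + (ρ / 2 * (u x t 0 * u x t 0 + u x t 1 * u x t 1) + ρ * g * elevation ζ φ x t) * hm

theorem integrableOn_kineticDensity (h : IsSmoothSolution Ω T ρ μ g ζ φ u)
    (hΩ : IsBoundedLipschitzDomain Ω) (ht : t ∈ Icc 0 T) :
    IntegrableOn (kineticDensity ρ φ u t) Ω := by
  have hu := fun i => ((h.isSmooth_velocity i).contDiffOn_slice ht).continuousOn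
  have hφ := (h.isSmooth_height.contDiffOn_slice ht).continuousOn
  refine hΩ.integrableOn_of_continuousOn ?_
  unfold kineticDensity
  simp only [norm_sq_plane]
  exact (continuousOn_const.mul hφ).mul (((hu 0).mul (hu 0)).add ((hu 1).mul (hu 1)))

theorem integrableOn_potentialDensity (h : IsSmoothSolution Ω T ρ μ g ζ φ u)
    (hΩ : IsBoundedLipschitzDomain Ω) (hζ : ContDiffOn ℝ 1 ζ (closure Ω)) (ht : t ∈ Icc 0 T) :
    IntegrableOn (potentialDensity ρ g ζ φ t) Ω :=
  hΩ.integrableOn_of_continuousOn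
    ((continuousOn_const.mul ((h.contDiffOn_elevation hζ ht).continuousOn.abs.pow 2)).div_const 2)

theorem integrableOn_dissipationDensity (h : IsSmoothSolution Ω T ρ μ g ζ φ u)
    (hΩ : IsBoundedLipschitzDomain Ω) (hT : 0 < T) (ht : t ∈ Icc 0 T) :
    IntegrableOn (dissipationDensity Ω φ u t) Ω :=
  hΩ.integrableOn_of_continuousOn ((h.isSmooth_height.contDiffOn_slice ht).continuousOn.mul
    (continuousOn_finsetSum _ fun i _ => continuousOn_finsetSum _ fun j _ =>
      ((h.isSmooth_strain hΩ hT i j).contDiffOn_slice ht).continuousOn.pow 2))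

theorem hasDerivWithinAt_energy (h : IsSmoothSolution Ω T ρ μ g ζ φ u)
    (hΩ : IsBoundedLipschitzDomain Ω) (hT : 0 < T) (hζ : ContDiffOn ℝ 1 ζ (closure Ω))
    (ht : t ∈ Icc 0 T) : HasDerivWithinAt (energy Ω ρ g ζ φ u)
      (∫ x in Ω, energyRate T ρ g ζ φ u x t) (Icc 0 T) t := by
  have hφ := h.isSmooth_height.continuousOn
  have hu := fun i => (h.isSmooth_velocity i).continuousOn
  have hφt := (h.isSmooth_height.tderiv hΩ hT).continuousOn
  have hut := fun i => ((h.isSmooth_velocity i).tderiv hΩ hT).continuousOn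
  have hζc : ContinuousOn (fun p : Plane × ℝ => ζ p.1) (closure Ω ×ˢ Icc 0 T) :=
    hζ.continuousOn.comp continuousOn_fst fun p hp => hp.1
  have hη : ContinuousOn (fun p : Plane × ℝ => elevation ζ φ p.1 p.2) (closure Ω ×ˢ Icc 0 T) :=
    hφ.sub hζc
  have hu2 := ((hu 0).mul (hu 0)).add ((hu 1).mul (hu 1))
  have hmain := hΩ.hasDerivWithinAt_setIntegral (T := T)
    (b := fun x t => ρ / 2 * (φ x t * (u x t 0 * u x t 0 + u x t 1 * u x t 1))
      + ρ * g * (elevation ζ φ x t * elevation ζ φ x t) / 2)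
    (b' := energyRate T ρ g ζ φ u) ?_ ?_ ?_ ht
  · refine hmain.congr_of_mem (fun s hs => ?_) ht
    rw [energy, ← integral_add (h.integrableOn_kineticDensity hΩ hs)
      (h.integrableOn_potentialDensity hΩ hζ hs)]
    refine integral_congr_ae (Eventually.of_forall fun x => ?_)
    simp only [kineticDensity, potentialDensity, norm_sq_plane, sq_abs]
    ring
  · exact (continuousOn_const.mul (hφ.mul hu2)).add
      ((continuousOn_const.mul (hη.mul hη)).div_const 2)
  · exact (continuousOn_const.mul ((hφt.mul hu2).add (hφ.mul
      (((continuousOn_const.mul (hu 0)).mul (hut 0)).add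
        ((continuousOn_const.mul (hu 1)).mul (hut 1)))))).add
      ((continuousOn_const.mul hη).mul hφt)
  · intro x hx s hs
    have dφ := h.isSmooth_height.hasDerivWithinAt hx hs
    have du := fun i => (h.isSmooth_velocity i).hasDerivWithinAt hx hs
    have dη : HasDerivWithinAt (fun s => elevation ζ φ x s) _ (Icc 0 T) s := dφ.sub_const (ζ x)
    have hd := ((dφ.mul (((du 0).mul (du 0)).add ((du 1).mul (du 1)))).const_mul (ρ / 2)).add
      (((dη.mul dη).const_mul (ρ * g)).div_const 2)
    refine hd.congr_deriv ?_
    simp only [energyRate, Pi.add_apply, Pi.mul_apply]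
    ring

end IsSmoothSolution

end Energy

end ShallowWater

theorem theorem1 (Ω : Set ShallowWater.Plane) (hΩ : ShallowWater.IsBoundedLipschitzDomain Ω)
    (T ρ μ g : ℝ) (hT : 0 < T) (hρ : 0 < ρ) (hμ : 0 < μ) (hg : 0 < g)
    (ζ : ShallowWater.Plane → ℝ) (hζ : ContDiffOn ℝ 1 ζ (closure Ω))
    (hζ_pos : ∀ x ∈ closure Ω, 0 < ζ x)
    (φ : ShallowWater.Plane → ℝ → ℝ) (u : ShallowWater.Plane → ℝ → ShallowWater.Plane)
    (hsol : ShallowWater.IsSmoothSolution Ω T ρ μ g ζ φ u) :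
    -- the outward unit normal exists almost everywhere on the boundary
    (∀ᵐ x ∂ShallowWater.arcLength Ω,
      ShallowWater.IsOutwardUnitNormal Ω x (ShallowWater.outwardNormal Ω x)) ∧
    ∀ t ∈ Icc 0 T,
      -- all the integrals converge
      IntegrableOn (ShallowWater.kineticDensity ρ φ u t) Ω ∧
      IntegrableOn (ShallowWater.potentialDensity ρ g ζ φ t) Ω ∧
      Integrable (ShallowWater.kineticFlux Ω φ u t) (ShallowWater.arcLength Ω) ∧
      Integrable (ShallowWater.potentialFlux Ω ζ φ u t) (ShallowWater.arcLength Ω) ∧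
      Integrable (ShallowWater.viscousFlux Ω φ u t) (ShallowWater.arcLength Ω) ∧
      IntegrableOn (ShallowWater.dissipationDensity Ω φ u t) Ω ∧
      -- the energy identity, with one-sided derivatives at the endpoints
      HasDerivWithinAt (ShallowWater.energy Ω ρ g ζ φ u)
        (ShallowWater.I₁ Ω ρ φ u t + ShallowWater.I₂ Ω ρ g ζ φ u t + ShallowWater.I₃ Ω μ φ u t
          + ShallowWater.I₄ Ω μ φ u t) (Icc 0 T) t := by
  refine ⟨hΩ.ae_isOutwardUnitNormal, fun t ht => ?_⟩
  obtain ⟨k1, k2, k3⟩ := hΩ.divergence_theorem (hsol.contDiffOn_kineticField ht)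
  obtain ⟨p1, p2, p3⟩ := hΩ.divergence_theorem (hsol.contDiffOn_potentialField hζ ht)
  obtain ⟨v1, v2, v3⟩ := hΩ.divergence_theorem (hsol.contDiffOn_viscousField hΩ hT ht)
  rw [← ShallowWater.kineticFlux_eq] at k2 k3
  rw [← ShallowWater.potentialFlux_eq] at p2 p3
  rw [← ShallowWater.viscousFlux_eq] at v2 v3
  have hd := hsol.integrableOn_dissipationDensity hΩ hT ht
  refine ⟨hsol.integrableOn_kineticDensity hΩ ht, hsol.integrableOn_potentialDensity hΩ hζ ht,
    k2, p2, v2, hd, (hsol.hasDerivWithinAt_energy hΩ hT hζ ht).congr_deriv ?_⟩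
  -- The local balance is available only in the open set `Ω`, which suffices here. The integral then
  -- splits into three divergences, each turned into a boundary flux, and the dissipation.
  rw [setIntegral_congr_fun hΩ.isOpen.measurableSet fun x hx =>
    hsol.energyRate_eq hΩ hT hζ ht hx]
  have hkp : IntegrableOn (fun x =>
      -(ρ / 2) * (∑ j, ShallowWater.pderiv Ω j (ShallowWater.kineticField φ u t j) x)
      + -(ρ * g) * (∑ j, ShallowWater.pderiv Ω j (ShallowWater.potentialField ζ φ u t j) x)) Ω :=
    (k1.const_mul _).add (p1.const_mul _)
  have hkpv : IntegrableOn (fun x =>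
      -(ρ / 2) * (∑ j, ShallowWater.pderiv Ω j (ShallowWater.kineticField φ u t j) x)
      + -(ρ * g) * (∑ j, ShallowWater.pderiv Ω j (ShallowWater.potentialField ζ φ u t j) x)
      + 2 * μ * (∑ j, ShallowWater.pderiv Ω j (ShallowWater.viscousField Ω φ u t j) x)) Ω :=
    hkp.add (v1.const_mul _)
  rw [integral_add hkpv (hd.const_mul _), integral_add hkp (v1.const_mul _),
    integral_add (k1.const_mul _) (p1.const_mul _), integral_const_mul, integral_const_mul,
    integral_const_mul, integral_const_mul, k3, p3, v3]
  rfl
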